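/- Let $R$ be a commutative unital ring, let $n\ge 0$ and $m\ge 1$ be integers, and let $f_1,\dots,f_m\in R\langle x_1,\dots,x_n\rangle$ be noncommutative polynomials. Differential graded (DG) algebras over $R$ are unital and $\mathbb Z$-graded, with a differential of degree $-1$ satisfying the graded Leibniz rule. Let $\mathcal A$ be the DG algebra whose underlying graded algebra is the free noncommutative $R$-algebra on generators $x_1,\dots,x_n$ of degree $0$ and $r_1,\dots,r_m$ of degree $1$, with differential determined by $\partial x_i=0$ and $\partial r_j=f_j$. Let $\mathcal B$ be the DG algebra with the same generators and with $\partial x_i=0$, $\partial r_j=1$. Then the following are equivalent: (a) $\mathcal A$ and $\mathcal B$ are stable tame isomorphic; (b) $\mathcal A$ and $\mathcal B$ are quasi-isomorphic; (c) $\mathcal A$ and $\mathcal B$ are derived Morita equivalent; (d) the algebra $A=R\langle x_1,\dots,x_n\rangle/(f_1,\dots,f_m)$ (quotient by the two-sided ideal) is zero. Here the terms mean the following. For a free graded algebra on finitely many homogeneous generators, an elementary automorphism sends one generator $y$ to $\alpha y+P$, where $\alpha\in R^\times$ and $P$ is a polynomial in the remaining generators, homogeneous of degree $|y|$, and fixes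 the remaining generators. Two DG algebras with free underlying algebras on given finite sets of homogeneous generators are tame isomorphic if some composition of elementary automorphisms, followed by the isomorphism induced by a degree-preserving bijection of the generators, commutes with the differentials. A stabilization adjoins two free generators $e,f$ of degrees $k+1,k$ for some $k\in\mathbb Z$, with $\partial e=f$, $\partial f=0$; two such DG algebras are stable tame isomorphic if they become tame isomorphic after finitely many stabilizations of each. Two DG algebras are quasi-isomorphic if they are related by a zigzag of DG algebra homomorphisms inducing isomorphisms on homology. Two DG algebras are derived Morita equivalent if their derived categories of left DG modules are equivalent as triangulated categories. -/

import Mathlib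

open CategoryTheory DirectSum

universe u

namespace DG

/-! ## Homology of a differential -/

/-- The homology `ker d / im d` of a group `M` with a differential `d`. If `M` is graded and `d` is
homogeneous, this is the direct sum `H_*` of the homology groups of all degrees, so that a map of
degree `0` induces an isomorphism on it if and only if it does so in every degree. -/
abbrev Homology {M : Type*} [AddCommGroup M] (d : M →+ M) : Type _ :=
  d.ker ⧸ d.range.addSubgroupOf d.ker

/-- The map induced on homology by a map that commutes with the differentials. -/
def homologyMap {M N : Type*} [AddCommGroup M] [AddCommGroup N] (d : M →+ M) (d' : N →+ N)
    (f : M →+ N) (h : ∀ x, f (d x) = d' (f x)) : Homology d →+ Homology d' :=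
  QuotientAddGroup.map _ _
    ((f.comp d.ker.subtype).codRestrict d'.ker (fun x => by
      have hx : d x = 0 := x.2
      change d' (f x) = 0
      rw [← h, hx, map_zero]))
    (by
      rintro ⟨x, hx⟩ ⟨y, hy⟩
      exact ⟨f y, by rw [← h, hy]; rfl⟩)

theorem homologyMap_bijective_iff {M N : Type*} [AddCommGroup M] [AddCommGroup N]
    (d : M →+ M) (d' : N →+ N) (f : M →+ N) (h : ∀ x, f (d x) = d' (f x)) :
    Function.Bijective (homologyMap d d' f h) ↔
      (∀ x, d x = 0 → (∃ y, d' y = f x) → ∃ z, d z = x) ∧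
      (∀ y, d' y = 0 → ∃ x, d x = 0 ∧ ∃ z, d' z = y - f x) := by
  constructor
  · rintro ⟨hi, hs⟩
    constructor
    · intro x hx hy
      have h0 : homologyMap d d' f h (QuotientAddGroup.mk ⟨x, hx⟩) = 0 :=
        (QuotientAddGroup.eq_zero_iff _).2 hy
      exact (QuotientAddGroup.eq_zero_iff (⟨x, hx⟩ : d.ker)).1 (hi (h0.trans (map_zero _).symm))
    · intro y hy
      obtain ⟨q, hq⟩ := hs (QuotientAddGroup.mk ⟨y, hy⟩)
      obtain ⟨⟨x, hx⟩, rfl⟩ := QuotientAddGroup.mk_surjective q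
      obtain ⟨z, hz⟩ := QuotientAddGroup.eq.1 hq
      refine ⟨x, hx, z, hz.trans ?_⟩
      change -f x + y = y - f x
      abel
  · rintro ⟨hi, hs⟩
    constructor
    · rw [injective_iff_map_eq_zero]
      intro q hq
      obtain ⟨⟨x, hx⟩, rfl⟩ := QuotientAddGroup.mk_surjective q
      obtain ⟨y, hy⟩ := (QuotientAddGroup.eq_zero_iff _).1 hq
      obtain ⟨z, hz⟩ := hi x hx ⟨y, hy⟩
      exact (QuotientAddGroup.eq_zero_iff _).2 ⟨z, hz⟩
    · intro q
      obtain ⟨⟨y, hy⟩, rfl⟩ := QuotientAddGroup.mk_surjective q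
      obtain ⟨x, hx, z, hz⟩ := hs y hy
      refine ⟨QuotientAddGroup.mk ⟨x, hx⟩, QuotientAddGroup.eq.2 ⟨z, hz.trans ?_⟩⟩
      change y - f x = -f x + y
      abel

/-! ## Differential graded algebras -/

/-- A differential graded algebra over `R`: a `ℤ`-graded unital `R`-algebra with a differential
of degree `-1` that satisfies the graded Leibniz rule. -/
structure DGAlgebra (R : Type u) [CommRing R] : Type (u + 1) where
  carrier : Type u
  [ring : Ring carrier]
  [algebra : Algebra R carrier]
  grading : ℤ → Submodule R carrier
  [gradedAlgebra : GradedAlgebra grading]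
  d : carrier →ₗ[R] carrier
  d_mem : ∀ (i : ℤ) (a : carrier), a ∈ grading i → d a ∈ grading (i - 1)
  d_d : ∀ a, d (d a) = 0
  leibniz : ∀ (i : ℤ) (a b : carrier), a ∈ grading i →
    d (a * b) = d a * b + i.negOnePow • (a * d b)

namespace DGAlgebra

variable {R : Type u} [CommRing R]

instance (A : DGAlgebra R) : Ring A.carrier := A.ring
instance (A : DGAlgebra R) : Algebra R A.carrier := A.algebra
instance (A : DGAlgebra R) : GradedAlgebra A.grading := A.gradedAlgebra

/-- A homomorphism of DG algebras. -/
structure Hom (A B : DGAlgebra R) where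
  toAlgHom : A.carrier →ₐ[R] B.carrier
  map_mem : ∀ (i : ℤ) (a : A.carrier), a ∈ A.grading i → toAlgHom a ∈ B.grading i
  map_d : ∀ a, toAlgHom (A.d a) = B.d (toAlgHom a)

/-- The additive map underlying a homomorphism of DG algebras. -/
def Hom.addHom {A B : DGAlgebra R} (f : Hom A B) : A.carrier →+ B.carrier :=
  f.toAlgHom.toLinearMap.toAddMonoidHom

theorem Hom.addHom_d {A B : DGAlgebra R} (f : Hom A B) (a : A.carrier) :
    f.addHom (A.d.toAddMonoidHom a) = B.d.toAddMonoidHom (f.addHom a) := f.map_d a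

/-- A DG homomorphism is a quasi-isomorphism if it induces an isomorphism on homology. -/
def Hom.IsQuasiIso {A B : DGAlgebra R} (f : Hom A B) : Prop :=
  Function.Bijective (homologyMap A.d.toAddMonoidHom B.d.toAddMonoidHom f.addHom f.addHom_d)

/-- Two DG algebras are quasi-isomorphic if a zigzag of quasi-isomorphisms relates them. -/
def QuasiIsomorphic (A B : DGAlgebra R) : Prop :=
  Relation.EqvGen (fun A B : DGAlgebra R => ∃ f : Hom A B, f.IsQuasiIso) A B

/-- The ring automorphism `a ↦ (-1)^|a| a` (for homogeneous `a`). -/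
def sign (A : DGAlgebra R) : A.carrier →+* A.carrier :=
  (DirectSum.toSemiring (A := fun i => A.grading i)
    (fun i => i.negOnePow • (A.grading i).subtype.toAddMonoidHom)
    (by
      change (0 : ℤ).negOnePow • (1 : A.carrier) = 1
      simp)
    (by
      intro i j a b
      change (i + j).negOnePow • ((a : A.carrier) * (b : A.carrier)) =
        (i.negOnePow • (a : A.carrier)) * (j.negOnePow • (b : A.carrier))
      rw [Int.negOnePow_add, smul_mul_smul_comm])).comp
    (DirectSum.decomposeRingEquiv A.grading : A.carrier →+* ⨁ i, A.grading i)

theorem sign_of_mem (A : DGAlgebra R) {i : ℤ} {a : A.carrier} (ha : a ∈ A.grading i) :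
    A.sign a = i.negOnePow • a := by
  change DirectSum.toAddMonoid (β := fun i => A.grading i)
    (fun i => i.negOnePow • (A.grading i).subtype.toAddMonoidHom)
    (DirectSum.decompose A.grading a) = _
  rw [DirectSum.decompose_of_mem A.grading ha]
  exact DirectSum.toAddMonoid_of _ _ _

end DGAlgebra

/-! ## DG modules -/

/-- A left DG module over the DG algebra `A`. (The scalars from `R` act through `A`; as they are
cycles of degree `0`, the grading and the differential are automatically `R`-linear.) -/
structure DGModule {R : Type u} [CommRing R] (A : DGAlgebra R) : Type (u + 1) where
  carrier : Type u
  [addCommGroup : AddCommGroup carrier]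
  [module : Module A.carrier carrier]
  grading : ℤ → AddSubgroup carrier
  isInternal : DirectSum.IsInternal grading
  smul_mem : ∀ (i j : ℤ) (a : A.carrier) (m : carrier), a ∈ A.grading i → m ∈ grading j →
    a • m ∈ grading (i + j)
  d : carrier →+ carrier
  d_mem : ∀ (i : ℤ) (m : carrier), m ∈ grading i → d m ∈ grading (i - 1)
  d_d : ∀ m, d (d m) = 0
  leibniz : ∀ (i : ℤ) (a : A.carrier) (m : carrier), a ∈ A.grading i →
    d (a • m) = A.d a • m + i.negOnePow • (a • d m)

theorem isInternal_reindex {M : Type*} [AddCommGroup M] {G : ℤ → AddSubgroup M}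
    (h : DirectSum.IsInternal G) (k : ℤ) : DirectSum.IsInternal (fun i => G (i - k)) := by
  have he : DirectSum.coeAddMonoidHom (fun i => G (i - k)) =
      (DirectSum.coeAddMonoidHom G).comp
        (DirectSum.toAddMonoid (fun i => DirectSum.of (fun i => G i) (i - k))) := by
    ext i x
    simp
  let g : (⨁ i, G i) →+ ⨁ i, G (i - k) := DirectSum.toAddMonoid (fun i =>
    (DirectSum.of (fun i => G (i - k)) (i + k)).comp
      (AddSubgroup.inclusion (le_of_eq (congrArg G (add_sub_cancel_right i k).symm))))
  have hof : ∀ {i j : ℤ} (hij : i = j) (x : M) (hi : x ∈ G i) (hj : x ∈ G j),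
      DirectSum.of (fun i => G i) i ⟨x, hi⟩ = DirectSum.of (fun i => G i) j ⟨x, hj⟩ := by
    rintro i _ rfl x _ _
    rfl
  have hof' : ∀ {i j : ℤ} (hij : i = j) (x : M) (hi : x ∈ G (i - k)) (hj : x ∈ G (j - k)),
      DirectSum.of (fun i => G (i - k)) i ⟨x, hi⟩ =
        DirectSum.of (fun i => G (i - k)) j ⟨x, hj⟩ := by
    rintro i _ rfl x _ _
    rfl
  have h1 : g.comp (DirectSum.toAddMonoid (fun i => DirectSum.of (fun i => G i) (i - k))) =
      AddMonoidHom.id _ := by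
    refine DirectSum.addHom_ext fun i x => ?_
    simp only [g, AddMonoidHom.comp_apply, DirectSum.toAddMonoid_of, AddMonoidHom.id_apply]
    exact hof' (sub_add_cancel i k) _ _ _
  have h2 : (DirectSum.toAddMonoid (fun i => DirectSum.of (fun i => G i) (i - k))).comp g =
      AddMonoidHom.id _ := by
    refine DirectSum.addHom_ext fun i x => ?_
    simp only [g, AddMonoidHom.comp_apply, DirectSum.toAddMonoid_of, AddMonoidHom.id_apply]
    exact hof (add_sub_cancel_right i k) _ _ _
  unfold DirectSum.IsInternal
  rw [he]
  exact h.comp (Function.bijective_iff_has_inverse.2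
    ⟨g, fun x => DFunLike.congr_fun h1 x, fun x => DFunLike.congr_fun h2 x⟩)

theorem isInternal_prod {M N : Type*} [AddCommGroup M] [AddCommGroup N]
    {G : ℤ → AddSubgroup M} {H : ℤ → AddSubgroup N} (hG : DirectSum.IsInternal G)
    (hH : DirectSum.IsInternal H) : DirectSum.IsInternal (fun i => (G i).prod (H i)) := by
  let p : (⨁ i, (G i).prod (H i)) →+ ⨁ i, G i := DirectSum.map (fun i =>
    ((AddMonoidHom.fst M N).comp ((G i).prod (H i)).subtype).codRestrict (G i) (fun x => x.2.1))
  let q : (⨁ i, (G i).prod (H i)) →+ ⨁ i, H i := DirectSum.map (fun i =>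
    ((AddMonoidHom.snd M N).comp ((G i).prod (H i)).subtype).codRestrict (H i) (fun x => x.2.2))
  let u : (⨁ i, G i) →+ ⨁ i, (G i).prod (H i) := DirectSum.map (fun i =>
    ((AddMonoidHom.inl M N).comp (G i).subtype).codRestrict ((G i).prod (H i))
      (fun x => ⟨x.2, zero_mem _⟩))
  let v : (⨁ i, H i) →+ ⨁ i, (G i).prod (H i) := DirectSum.map (fun i =>
    ((AddMonoidHom.inr M N).comp (H i).subtype).codRestrict ((G i).prod (H i))
      (fun x => ⟨zero_mem _, x.2⟩))
  have hc : DirectSum.coeAddMonoidHom (fun i => (G i).prod (H i)) =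
      ((DirectSum.coeAddMonoidHom G).comp p).prod ((DirectSum.coeAddMonoidHom H).comp q) := by
    refine DirectSum.addHom_ext fun i x => ?_
    simp only [p, q, AddMonoidHom.prod_apply, AddMonoidHom.comp_apply, DirectSum.map_of,
      DirectSum.coeAddMonoidHom_of]
    rfl
  have huv : u.comp p + v.comp q = AddMonoidHom.id _ := by
    refine DirectSum.addHom_ext fun i x => ?_
    simp only [u, v, p, q, AddMonoidHom.add_apply, AddMonoidHom.comp_apply, DirectSum.map_of,
      AddMonoidHom.id_apply, ← map_add]
    congr 1
    refine Subtype.ext (Prod.ext ?_ ?_)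
    · exact add_zero _
    · exact zero_add _
  have hpu : ∀ x y, p (u x + v y) = x := by
    have h1 : p.comp u = AddMonoidHom.id _ := by
      refine DirectSum.addHom_ext fun i x => ?_
      simp only [p, u, AddMonoidHom.comp_apply, DirectSum.map_of]
      rfl
    have h2 : p.comp v = 0 := by
      refine DirectSum.addHom_ext fun i x => ?_
      simp only [p, v, AddMonoidHom.comp_apply, DirectSum.map_of]
      exact (DirectSum.of (fun i => G i) i).map_zero
    intro x y
    rw [map_add]
    exact (congrArg₂ (· + ·) (DFunLike.congr_fun h1 x) (DFunLike.congr_fun h2 y)).trans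
      (add_zero _)
  have hqv : ∀ x y, q (u x + v y) = y := by
    have h1 : q.comp v = AddMonoidHom.id _ := by
      refine DirectSum.addHom_ext fun i x => ?_
      simp only [q, v, AddMonoidHom.comp_apply, DirectSum.map_of]
      rfl
    have h2 : q.comp u = 0 := by
      refine DirectSum.addHom_ext fun i x => ?_
      simp only [q, u, AddMonoidHom.comp_apply, DirectSum.map_of]
      exact (DirectSum.of (fun i => H i) i).map_zero
    intro x y
    rw [map_add]
    exact (congrArg₂ (· + ·) (DFunLike.congr_fun h2 x) (DFunLike.congr_fun h1 y)).trans
      (zero_add _)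
  unfold DirectSum.IsInternal
  rw [hc]
  constructor
  · intro x y hxy
    have h1 : p x = p y := hG.1 (congrArg Prod.fst hxy)
    have h2 : q x = q y := hH.1 (congrArg Prod.snd hxy)
    have hx : u (p x) + v (q x) = x := DFunLike.congr_fun huv x
    have hy : u (p y) + v (q y) = y := DFunLike.congr_fun huv y
    rw [← hx, ← hy, h1, h2]
  · rintro ⟨m, n⟩
    obtain ⟨x, rfl⟩ := hG.2 m
    obtain ⟨y, rfl⟩ := hH.2 n
    refine ⟨u x + v y, ?_⟩
    simp only [AddMonoidHom.prod_apply, AddMonoidHom.comp_apply, hpu, hqv]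

namespace DGModule

variable {R : Type u} [CommRing R] {A : DGAlgebra R}

instance (M : DGModule A) : AddCommGroup M.carrier := M.addCommGroup
instance (M : DGModule A) : Module A.carrier M.carrier := M.module

/-- Morphisms of DG modules: `A`-linear maps of degree `0` that commute with the differentials. -/
@[ext]
structure Hom (M N : DGModule A) where
  toLinearMap : M.carrier →ₗ[A.carrier] N.carrier
  map_mem : ∀ (i : ℤ) (m : M.carrier), m ∈ M.grading i → toLinearMap m ∈ N.grading i
  map_d : ∀ m, toLinearMap (M.d m) = N.d (toLinearMap m)

instance : Category (DGModule A) where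
  Hom := Hom
  id M := ⟨LinearMap.id, fun _ _ h => h, fun _ => rfl⟩
  comp f g := ⟨g.toLinearMap.comp f.toLinearMap,
    fun i m h => g.map_mem i _ (f.map_mem i m h),
    fun m => (congrArg g.toLinearMap (f.map_d m)).trans (g.map_d _)⟩

/-- The additive map underlying a morphism of DG modules. -/
def Hom.addHom {M N : DGModule A} (f : Hom M N) : M.carrier →+ N.carrier :=
  f.toLinearMap.toAddMonoidHom

theorem Hom.addHom_d {M N : DGModule A} (f : Hom M N) (m : M.carrier) :
    f.addHom (M.d m) = N.d (f.addHom m) := f.map_d m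

/-- The class of quasi-isomorphisms of DG modules: the morphisms that induce an isomorphism on
homology. -/
def quasiIso (A : DGAlgebra R) : MorphismProperty (DGModule A) := fun M N f =>
  Function.Bijective (homologyMap M.d N.d (Hom.addHom f) (Hom.addHom_d f))

/-- The shift `M[1]`: `(M[1])_i = M_{i-1}`, with differential `-d`, and with `a ∈ A` acting on it
as `(-1)^|a| a` acts on `M`. -/
def shift (M : DGModule A) : DGModule A where
  carrier := M.carrier
  addCommGroup := M.addCommGroup
  module := Module.compHom M.carrier A.sign
  grading i := M.grading (i - 1)
  isInternal := isInternal_reindex M.isInternal 1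
  smul_mem i j a m ha hm := by
    change A.sign a • m ∈ _
    rw [A.sign_of_mem ha, show i + j - 1 = i + (j - 1) by ring]
    refine M.smul_mem i (j - 1) _ m ?_ hm
    rw [Units.smul_def]
    exact zsmul_mem ha _
  d := -M.d
  d_mem i m hm := (M.grading _).neg_mem (M.d_mem _ m hm)
  d_d m := by
    change -M.d (-M.d m) = 0
    simp [M.d_d]
  leibniz i a m ha := by
    change -M.d (A.sign a • m) = A.sign (A.d a) • m + i.negOnePow • (A.sign a • -M.d m)
    rw [A.sign_of_mem ha, A.sign_of_mem (A.d_mem i a ha), Int.negOnePow_sub, Int.negOnePow_one]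
    rcases Int.units_eq_one_or i.negOnePow with h | h
    · simp [h, M.leibniz i a m ha, add_comm]
    · simp [h, M.leibniz i a m ha]

/-- The shift of a morphism: the same map on elements. -/
def shiftMap {M N : DGModule A} (f : M ⟶ N) : shift M ⟶ shift N :=
  (⟨{ toFun := fun m : M.carrier => (Hom.toLinearMap f m : N.carrier)
      map_add' := fun x y => (Hom.toLinearMap f).map_add x y
      map_smul' := fun a x => (Hom.toLinearMap f).map_smul (A.sign a) x },
    fun i m h => Hom.map_mem f (i - 1) m h,
    fun m => ((Hom.toLinearMap f).map_neg _).trans (congrArg Neg.neg (Hom.map_d f m))⟩ :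
    Hom (shift M) (shift N))

/-- The shift as a functor on DG modules. -/
def shiftFunctor (A : DGAlgebra R) : DGModule A ⥤ DGModule A where
  obj := shift
  map := shiftMap

/-- The mapping cone of `f : M ⟶ N`: the graded module `N ⊕ M[1]` with differential
`(n, m) ↦ (d n + f m, -d m)`. -/
def cone {M N : DGModule A} (f : M ⟶ N) : DGModule A where
  carrier := N.carrier × (shift M).carrier
  grading i := (N.grading i).prod ((shift M).grading i)
  isInternal := isInternal_prod N.isInternal (shift M).isInternal
  smul_mem i j a m ha hm :=
    ⟨N.smul_mem i j a m.1 ha hm.1, (shift M).smul_mem i j a m.2 ha hm.2⟩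
  d := AddMonoidHom.prod
    (N.d.comp (AddMonoidHom.fst N.carrier M.carrier) +
      (Hom.addHom f).comp (AddMonoidHom.snd N.carrier M.carrier))
    ((shift M).d.comp (AddMonoidHom.snd N.carrier (shift M).carrier))
  d_mem i m hm := by
    refine ⟨?_, (shift M).d_mem i _ hm.2⟩
    change N.d m.1 + Hom.addHom f m.2 ∈ N.grading (i - 1)
    exact add_mem (N.d_mem i _ hm.1) (Hom.map_mem f (i - 1) _ hm.2)
  d_d := by
    rintro ⟨n, (m : M.carrier)⟩
    refine Prod.ext ?_ ((shift M).d_d m)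
    change N.d (N.d n + Hom.addHom f m) + Hom.addHom f (-M.d m) = 0
    rw [map_add, N.d_d, map_neg, Hom.addHom_d]
    abel
  leibniz := by
    rintro i a ⟨n, (m : M.carrier)⟩ ha
    refine Prod.ext ?_ ((shift M).leibniz i a m ha)
    change N.d (a • n) + Hom.toLinearMap f (A.sign a • m) =
      A.d a • n + i.negOnePow • (a • (N.d n + Hom.toLinearMap f m))
    rw [N.leibniz i a n ha, A.sign_of_mem ha, map_smul, smul_add, smul_add, smul_assoc, add_assoc]

/-- The inclusion `N ⟶ cone f`. -/
def coneInl {M N : DGModule A} (f : M ⟶ N) : N ⟶ cone f :=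
  (⟨LinearMap.inl A.carrier N.carrier (shift M).carrier,
    fun _ _ h => ⟨h, zero_mem _⟩, fun n => by
      refine Prod.ext ?_ (map_zero (shift M).d).symm
      change N.d n = N.d n + Hom.addHom f 0
      rw [map_zero, add_zero]⟩ : Hom N (cone f))

/-- The projection `cone f ⟶ M[1]`. -/
def coneProj {M N : DGModule A} (f : M ⟶ N) : cone f ⟶ shift M :=
  (⟨LinearMap.snd A.carrier N.carrier (shift M).carrier,
    fun _ _ h => h.2, fun _ => rfl⟩ : Hom (cone f) (shift M))

theorem quasiIso_shiftMap {M N : DGModule A} (f : M ⟶ N) (hf : quasiIso A f) :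
    quasiIso A (shiftMap f) := by
  rw [quasiIso, homologyMap_bijective_iff] at hf ⊢
  obtain ⟨h1, h2⟩ := hf
  constructor
  · rintro (x : M.carrier) hx ⟨y, hy⟩
    obtain ⟨z, hz⟩ := h1 x (neg_eq_zero.1 hx) ⟨-y, (map_neg N.d y).trans hy⟩
    exact ⟨-z, (congrArg Neg.neg (map_neg M.d z)).trans ((neg_neg _).trans hz)⟩
  · rintro (y : N.carrier) hy
    obtain ⟨x, hx, z, hz⟩ := h2 y (neg_eq_zero.1 hy)
    exact ⟨x, neg_eq_zero.2 hx, -z,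
      (congrArg Neg.neg (map_neg N.d z)).trans ((neg_neg _).trans hz)⟩

end DGModule

/-! ## The derived category -/

section Derived

variable {R : Type u} [CommRing R]

/-- The derived category `D(A)`: left DG modules localized at the quasi-isomorphisms. -/
abbrev DerivedCat (A : DGAlgebra R) : Type (u + 1) := (DGModule.quasiIso A).Localization

/-- The localization functor from DG modules to `D(A)`. -/
abbrev DerivedCat.Q (A : DGAlgebra R) : DGModule A ⥤ DerivedCat A := (DGModule.quasiIso A).Q

/-- The shift functor of `D(A)`, induced by the shift of DG modules. -/
noncomputable def DerivedCat.shift (A : DGAlgebra R) : DerivedCat A ⥤ DerivedCat A :=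
  Localization.Construction.lift (DGModule.shiftFunctor A ⋙ DerivedCat.Q A)
    (fun _ _ f hf => MorphismProperty.Q_inverts _ _ (DGModule.quasiIso_shiftMap f hf))

/-- A triangle `X ⟶ Y ⟶ Z ⟶ X[1]` of `D(A)` is distinguished if it is isomorphic, in `D(A)`, to
the triangle `M ⟶ N ⟶ cone φ ⟶ M[1]` of some morphism `φ` of DG modules. -/
def DerivedCat.IsDistinguished {A : DGAlgebra R} {X Y Z : DerivedCat A}
    (f : X ⟶ Y) (g : Y ⟶ Z) (h : Z ⟶ (DerivedCat.shift A).obj X) : Prop :=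
  ∃ (M N : DGModule A) (φ : M ⟶ N) (a : X ≅ (DerivedCat.Q A).obj M)
    (b : Y ≅ (DerivedCat.Q A).obj N) (c : Z ≅ (DerivedCat.Q A).obj (DGModule.cone φ)),
    f ≫ b.hom = a.hom ≫ (DerivedCat.Q A).map φ ∧
    g ≫ c.hom = b.hom ≫ (DerivedCat.Q A).map (DGModule.coneInl φ) ∧
    h ≫ (DerivedCat.shift A).map a.hom =
      c.hom ≫ (DerivedCat.Q A).map (DGModule.coneProj φ)

/-- `A` and `B` are derived Morita equivalent if `D(A)` and `D(B)` are equivalent as triangulated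
categories: some equivalence of categories commutes with the shifts up to a natural isomorphism
that makes it send distinguished triangles to distinguished triangles. (An equivalence between
additive categories is automatically additive.) -/
def DerivedMoritaEquivalent (A B : DGAlgebra R) : Prop :=
  ∃ (F : DerivedCat A ≌ DerivedCat B)
    (η : DerivedCat.shift A ⋙ F.functor ≅ F.functor ⋙ DerivedCat.shift B),
    ∀ (X Y Z : DerivedCat A) (f : X ⟶ Y) (g : Y ⟶ Z) (h : Z ⟶ (DerivedCat.shift A).obj X),
      DerivedCat.IsDistinguished f g h →
        DerivedCat.IsDistinguished (F.functor.map f) (F.functor.map g)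
          (F.functor.map h ≫ η.hom.app X)

end Derived

/-! ## Free algebras on graded generators -/

section Free

variable {R : Type u} [CommRing R] {ι κ : Type}

/-- The homogeneous part of degree `n` of the free algebra on generators of degrees `deg`: the span
of the words of total degree `n`. -/
def wordGrading (R : Type u) [CommRing R] {ι : Type} (deg : ι → ℤ) (n : ℤ) :
    Submodule R (FreeAlgebra R ι) :=
  Submodule.span R {a | ∃ w : List ι, (w.map deg).sum = n ∧ a = (w.map (FreeAlgebra.ι R)).prod}

theorem ι_mem_wordGrading (deg : ι → ℤ) (i : ι) :
    FreeAlgebra.ι R i ∈ wordGrading R deg (deg i) :=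
  Submodule.subset_span ⟨[i], by simp, by simp⟩

instance (deg : ι → ℤ) : SetLike.GradedMonoid (wordGrading R deg) where
  one_mem := Submodule.subset_span ⟨[], by simp, by simp⟩
  mul_mem := by
    intro i j a b ha hb
    have h := Submodule.mul_mem_mul ha hb
    rw [wordGrading, wordGrading, Submodule.span_mul_span] at h
    refine Submodule.span_mono ?_ h
    rintro _ ⟨_, ⟨v, hv, rfl⟩, _, ⟨w, hw, rfl⟩, rfl⟩
    exact ⟨v ++ w, by simp [hv, hw], by simp⟩

/-- The map of the free algebra into the sum of its homogeneous parts. -/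
def toWordGrading (R : Type u) [CommRing R] {ι : Type} (deg : ι → ℤ) :
    FreeAlgebra R ι →ₐ[R] ⨁ n, wordGrading R deg n :=
  FreeAlgebra.lift R (fun i =>
    DirectSum.of (fun n => wordGrading R deg n) (deg i) ⟨_, ι_mem_wordGrading deg i⟩)

instance wordGradedAlgebra (deg : ι → ℤ) : GradedAlgebra (wordGrading R deg) :=
  GradedAlgebra.ofAlgHom _ (toWordGrading R deg)
    (by
      ext i
      simp [toWordGrading])
    (by
      rintro n ⟨a, ha⟩
      induction ha using Submodule.span_induction with
      | mem a ha =>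
        obtain ⟨w, hw, rfl⟩ := ha
        have key : ∀ (w : List ι) (n : ℤ) (hn : (w.map deg).sum = n),
            toWordGrading R deg (w.map (FreeAlgebra.ι R)).prod =
              DirectSum.of (fun n => wordGrading R deg n) n
                ⟨_, Submodule.subset_span ⟨w, hn, rfl⟩⟩ := by
          intro w
          induction w with
          | nil =>
            rintro n rfl
            simp only [List.map_nil, List.prod_nil, map_one]
            rfl
          | cons i w ih =>
            rintro n rfl
            simp only [List.map_cons, List.prod_cons, map_mul]
            rw [ih _ rfl, toWordGrading, FreeAlgebra.lift_ι_apply, DirectSum.of_mul_of]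
            rfl
        exact key w n hw
      | zero =>
        rw [show (⟨0, _⟩ : wordGrading R deg n) = 0 from rfl, map_zero]
        exact map_zero _
      | add a b ha hb iha ihb =>
        change toWordGrading R deg (a + b) = DirectSum.of (fun n => wordGrading R deg n) n
          (⟨a, ha⟩ + ⟨b, hb⟩)
        rw [map_add, map_add]
        exact congrArg₂ (· + ·) iha ihb
      | smul r a ha iha =>
        change toWordGrading R deg (r • a) = DirectSum.lof R ℤ (fun n => wordGrading R deg n) n
          (r • ⟨a, ha⟩)
        rw [map_smul, map_smul]
        exact congrArg (r • ·) iha)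

/-- The automorphism `a ↦ (-1)^|a| a` of the free algebra. -/
def freeSign (R : Type u) [CommRing R] {ι : Type} (deg : ι → ℤ) :
    FreeAlgebra R ι →ₐ[R] FreeAlgebra R ι :=
  FreeAlgebra.lift R (fun i => (deg i).negOnePow • FreeAlgebra.ι R i)

/-- The algebra homomorphism `a ↦ !![(-1)^|a| a, ∂ a; 0, a]`, where `∂` is the extension of
`∂ x_i = dgen i` by the graded Leibniz rule. -/
def freeDMatrix (deg : ι → ℤ) (dgen : ι → FreeAlgebra R ι) :
    FreeAlgebra R ι →ₐ[R] Matrix (Fin 2) (Fin 2) (FreeAlgebra R ι) :=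
  FreeAlgebra.lift R (fun i =>
    !![freeSign R deg (FreeAlgebra.ι R i), dgen i; 0, FreeAlgebra.ι R i])

/-- The extension of `∂ x_i = dgen i` to the free algebra by linearity and the graded Leibniz rule
`∂ (a b) = (∂ a) b + (-1)^|a| a (∂ b)`. -/
def freeD (deg : ι → ℤ) (dgen : ι → FreeAlgebra R ι) : FreeAlgebra R ι →ₗ[R] FreeAlgebra R ι where
  toFun a := freeDMatrix deg dgen a 0 1
  map_add' a b := by simp
  map_smul' r a := by simp

theorem freeD_ι (deg : ι → ℤ) (dgen : ι → FreeAlgebra R ι) (i : ι) :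
    freeD deg dgen (FreeAlgebra.ι R i) = dgen i := by
  simp [freeD, freeDMatrix]

theorem freeD_mul (deg : ι → ℤ) (dgen : ι → FreeAlgebra R ι) (a b : FreeAlgebra R ι) :
    freeD deg dgen (a * b) =
      freeD deg dgen a * b + freeSign R deg a * freeD deg dgen b := by
  have h : ∀ a, freeDMatrix deg dgen a =
      !![freeSign R deg a, freeD deg dgen a; 0, a] := by
    intro a
    have h0 : freeDMatrix deg dgen a 0 0 = freeSign R deg a ∧ freeDMatrix deg dgen a 1 0 = 0 ∧
        freeDMatrix deg dgen a 1 1 = a := by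
      induction a using FreeAlgebra.induction with
      | grade0 r => simp [Matrix.algebraMap_matrix_apply]
      | grade1 i => simp [freeDMatrix]
      | mul a b ha hb => simp [Matrix.mul_apply, ha, hb]
      | add a b ha hb => simp [ha, hb]
    ext i j
    fin_cases i <;> fin_cases j <;> simp [h0, freeD]
  change freeDMatrix deg dgen (a * b) 0 1 = _
  rw [map_mul, h a, h b]
  simp [Matrix.mul_apply, add_comm]

/-- The homomorphism of free algebras that sends the generator `x_i` to the generator `x_{g i}`. -/
def relabel (R : Type u) [CommRing R] {ι κ : Type} (g : ι → κ) :
    FreeAlgebra R ι →ₐ[R] FreeAlgebra R κ :=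
  FreeAlgebra.lift R (fun i => FreeAlgebra.ι R (g i))


theorem freeSign_of_mem (deg : ι → ℤ) {n : ℤ} {a : FreeAlgebra R ι}
    (ha : a ∈ wordGrading R deg n) : freeSign R deg a = n.negOnePow • a := by
  induction ha using Submodule.span_induction with
  | mem a ha =>
    obtain ⟨w, rfl, rfl⟩ := ha
    induction w with
    | nil => simp
    | cons i w ih =>
      simp only [List.map_cons, List.prod_cons, List.sum_cons, map_mul, ih]
      rw [freeSign, FreeAlgebra.lift_ι_apply, Int.negOnePow_add, smul_mul_smul_comm]
  | zero => simp
  | add a b _ _ iha ihb => rw [map_add, iha, ihb, smul_add]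
  | smul r a _ iha => rw [map_smul, iha, smul_comm]

theorem freeD_leibniz (deg : ι → ℤ) (dgen : ι → FreeAlgebra R ι) {n : ℤ} (a b : FreeAlgebra R ι)
    (ha : a ∈ wordGrading R deg n) : freeD deg dgen (a * b) =
      freeD deg dgen a * b + n.negOnePow • (a * freeD deg dgen b) := by
  rw [freeD_mul, freeSign_of_mem deg ha, smul_mul_assoc]

theorem freeD_algebraMap (deg : ι → ℤ) (dgen : ι → FreeAlgebra R ι) (r : R) :
    freeD deg dgen (algebraMap R _ r) = 0 := by
  simp [freeD, Matrix.algebraMap_matrix_apply]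

theorem freeD_mem (deg : ι → ℤ) (dgen : ι → FreeAlgebra R ι)
    (h : ∀ i, dgen i ∈ wordGrading R deg (deg i - 1)) (n : ℤ) (a : FreeAlgebra R ι)
    (ha : a ∈ wordGrading R deg n) : freeD deg dgen a ∈ wordGrading R deg (n - 1) := by
  induction ha using Submodule.span_induction with
  | mem a ha =>
    obtain ⟨w, rfl, rfl⟩ := ha
    induction w with
    | nil =>
      have := freeD_algebraMap deg dgen 1
      simp only [map_one] at this
      simp [this]
    | cons i w ih =>
      simp only [List.map_cons, List.prod_cons, List.sum_cons]
      rw [freeD_leibniz deg dgen _ _ (ι_mem_wordGrading deg i), freeD_ι]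
      refine add_mem ?_ ?_
      · rw [add_sub_right_comm]
        exact SetLike.mul_mem_graded (h i) (Submodule.subset_span ⟨w, rfl, rfl⟩)
      · rw [Units.smul_def, add_sub_assoc]
        exact zsmul_mem (SetLike.mul_mem_graded (ι_mem_wordGrading deg i) ih) _
  | zero => simp
  | add a b _ _ iha ihb =>
    rw [map_add]
    exact add_mem iha ihb
  | smul r a _ iha =>
    rw [map_smul]
    exact Submodule.smul_mem _ r iha

theorem freeD_freeD (deg : ι → ℤ) (dgen : ι → FreeAlgebra R ι)
    (h : ∀ i, dgen i ∈ wordGrading R deg (deg i - 1))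
    (h0 : ∀ i, freeD deg dgen (dgen i) = 0) (a : FreeAlgebra R ι) :
    freeD deg dgen (freeD deg dgen a) = 0 := by
  have hs : ∀ a, freeSign R deg (freeD deg dgen a) = -freeD deg dgen (freeSign R deg a) := by
    intro a
    induction a using FreeAlgebra.induction with
    | grade0 r => simp [freeD_algebraMap]
    | grade1 i =>
      rw [freeD_ι, freeSign_of_mem deg (h i), freeSign_of_mem deg (ι_mem_wordGrading deg i),
        Units.smul_def, Units.smul_def, map_zsmul, freeD_ι, Int.negOnePow_sub, Int.negOnePow_one]
      simp
    | mul a b ha hb =>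
      rw [freeD_mul, map_mul, freeD_mul, map_add, map_mul, map_mul, ha, hb]
      simp [add_comm]
    | add a b ha hb => rw [map_add, map_add, ha, hb, map_add, map_add, neg_add]
  induction a using FreeAlgebra.induction with
  | grade0 r => simp [freeD_algebraMap]
  | grade1 i => rw [freeD_ι, h0]
  | mul a b ha hb =>
    rw [freeD_mul, map_add, freeD_mul, freeD_mul, ha, hb, hs]
    simp
  | add a b ha hb => rw [map_add, map_add, ha, hb, add_zero]

theorem relabel_mem (g : ι → κ) (deg : ι → ℤ) (deg' : κ → ℤ) (h : ∀ i, deg' (g i) = deg i)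
    {n : ℤ} {a : FreeAlgebra R ι} (ha : a ∈ wordGrading R deg n) :
    relabel R g a ∈ wordGrading R deg' n := by
  induction ha using Submodule.span_induction with
  | mem a ha =>
    obtain ⟨w, rfl, rfl⟩ := ha
    refine Submodule.subset_span ⟨w.map g, ?_, ?_⟩
    · simp [Function.comp_def, h]
    · simp [relabel, map_list_prod, Function.comp_def]
  | zero => simp
  | add a b _ _ iha ihb =>
    rw [map_add]
    exact add_mem iha ihb
  | smul r a _ iha =>
    rw [map_smul]
    exact Submodule.smul_mem _ r iha

theorem freeD_relabel (g : ι → κ) (deg : ι → ℤ) (deg' : κ → ℤ) (h : ∀ i, deg' (g i) = deg i)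
    (dgen : ι → FreeAlgebra R ι) (dgen' : κ → FreeAlgebra R κ)
    (hd : ∀ i, dgen' (g i) = relabel R g (dgen i)) (a : FreeAlgebra R ι) :
    freeD deg' dgen' (relabel R g a) = relabel R g (freeD deg dgen a) := by
  have hs : ∀ a, freeSign R deg' (relabel R g a) = relabel R g (freeSign R deg a) := by
    intro a
    have : (freeSign R deg').comp (relabel R g) = (relabel R g).comp (freeSign R deg) := by
      ext i
      simp [freeSign, relabel, h, Units.smul_def]
    exact DFunLike.congr_fun this a
  induction a using FreeAlgebra.induction with
  | grade0 r => simp [freeD_algebraMap]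
  | grade1 i =>
    rw [freeD_ι, ← hd, relabel, FreeAlgebra.lift_ι_apply, freeD_ι]
  | mul a b ha hb => simp only [map_mul, freeD_mul, map_add, ha, hb, hs]
  | add a b ha hb => simp only [map_add, ha, hb]

end Free

/-! ## Semifree DG algebras -/

/-- A semifree DG algebra: the free algebra on finitely many generators `x_i` of degrees `deg i`,
with the differential determined by `∂ x_i = dgen i`. -/
structure SemifreeDGA (R : Type u) [CommRing R] where
  ι : Type
  [finite : Finite ι]
  deg : ι → ℤ
  dgen : ι → FreeAlgebra R ι
  dgen_mem : ∀ i, dgen i ∈ wordGrading R deg (deg i - 1)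
  d_dgen : ∀ i, freeD deg dgen (dgen i) = 0

namespace SemifreeDGA

variable {R : Type u} [CommRing R]

/-- The differential of a semifree DG algebra. -/
abbrev d (A : SemifreeDGA R) : FreeAlgebra R A.ι →ₗ[R] FreeAlgebra R A.ι := freeD A.deg A.dgen

/-- The DG algebra underlying a semifree DG algebra. -/
def toDGAlgebra (A : SemifreeDGA R) : DGAlgebra R where
  carrier := FreeAlgebra R A.ι
  grading := wordGrading R A.deg
  d := A.d
  d_mem := freeD_mem A.deg A.dgen A.dgen_mem
  d_d := freeD_freeD A.deg A.dgen A.dgen_mem A.d_dgen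
  leibniz _ a b ha := freeD_leibniz A.deg A.dgen a b ha

/-- An elementary automorphism: it sends one generator `x_i` to `α x_i + P` with `α` a unit of `R`
and `P` a homogeneous polynomial, of the degree of `x_i`, in the other generators, and it fixes the
other generators. -/
def IsElementary {ι : Type} (deg : ι → ℤ) (φ : FreeAlgebra R ι ≃ₐ[R] FreeAlgebra R ι) : Prop :=
  ∃ (i : ι) (α : Rˣ) (P : FreeAlgebra R ι),
    P ∈ wordGrading R deg (deg i) ∧
    P ∈ Algebra.adjoin R (FreeAlgebra.ι R '' {j | j ≠ i}) ∧
    φ (FreeAlgebra.ι R i) = (α : R) • FreeAlgebra.ι R i + P ∧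
    ∀ j, j ≠ i → φ (FreeAlgebra.ι R j) = FreeAlgebra.ι R j

/-- Two semifree DG algebras are tame isomorphic if a composition of elementary automorphisms,
followed by a degree-preserving bijection of the generators, commutes with the differentials. -/
def TameIsomorphic (A B : SemifreeDGA R) : Prop :=
  ∃ φ ∈ Submonoid.closure {φ : FreeAlgebra R A.ι ≃ₐ[R] FreeAlgebra R A.ι | IsElementary A.deg φ},
    ∃ σ : A.ι ≃ B.ι, (∀ i, B.deg (σ i) = A.deg i) ∧
      ∀ a, relabel R σ (φ (A.d a)) = B.d (relabel R σ (φ a))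

/-- The stabilization of `A` in degree `k`: two more generators `e = inr true` of degree `k + 1`
and `f = inr false` of degree `k`, with `∂ e = f` and `∂ f = 0`. -/
def stabilize (A : SemifreeDGA R) (k : ℤ) : SemifreeDGA R where
  ι := A.ι ⊕ Bool
  finite := haveI := A.finite; inferInstance
  deg := Sum.elim A.deg (fun b => if b then k + 1 else k)
  dgen := Sum.elim (fun i => relabel R Sum.inl (A.dgen i))
    (fun b => if b then FreeAlgebra.ι R (Sum.inr false) else 0)
  dgen_mem := by
    rintro (i | _ | _)
    · exact relabel_mem Sum.inl A.deg _ (fun _ => rfl) (A.dgen_mem i)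
    · exact zero_mem _
    · have h := ι_mem_wordGrading (R := R)
        (Sum.elim A.deg (fun b : Bool => if b then k + 1 else k)) (Sum.inr false)
      simpa using h
  d_dgen := by
    rintro (i | _ | _)
    · refine (freeD_relabel Sum.inl A.deg _ (fun _ => rfl) A.dgen _ (fun _ => rfl) _).trans ?_
      rw [A.d_dgen, map_zero]
    · exact map_zero _
    · exact freeD_ι _ _ _

/-- Two semifree DG algebras are stable tame isomorphic if they become tame isomorphic after
finitely many stabilizations of each. -/
def StableTameIsomorphic (A B : SemifreeDGA R) : Prop :=
  ∃ ks ls : List ℤ, TameIsomorphic (ks.foldl stabilize A) (ls.foldl stabilize B)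

/-- The semifree DG algebra over `R` with generators `x_1, …, x_n` of degree `0`, generators `r_1, …, r_m`
of degree `1`, and differential `∂ x_i = 0`, `∂ r_j = f j`. -/
def ofRelations {n m : ℕ} (f : Fin m → FreeAlgebra R (Fin n)) : SemifreeDGA R where
  ι := Fin n ⊕ Fin m
  deg := Sum.elim (fun _ => 0) (fun _ => 1)
  dgen := Sum.elim (fun _ => 0) (fun j => relabel R Sum.inl (f j))
  dgen_mem := by
    rintro (i | j)
    · exact zero_mem _
    · have h : f j ∈ wordGrading R (fun _ : Fin n => (0 : ℤ)) 0 := by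
        induction f j using FreeAlgebra.induction with
        | grade0 r => exact SetLike.algebraMap_mem_graded _ r
        | grade1 i => exact ι_mem_wordGrading _ i
        | mul a b ha hb => simpa using SetLike.mul_mem_graded ha hb
        | add a b ha hb => exact add_mem ha hb
      exact relabel_mem Sum.inl _ _ (fun _ => rfl) h
  d_dgen := by
    rintro (i | j)
    · exact map_zero _
    · refine (freeD_relabel Sum.inl (fun _ : Fin n => (0 : ℤ)) _ (fun _ => rfl) (fun _ => 0) _
        (fun _ => (map_zero _).symm) _).trans ?_
      have h : ∀ a : FreeAlgebra R (Fin n), freeD (fun _ => (0 : ℤ)) (fun _ => 0) a = 0 := by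
        intro a
        induction a using FreeAlgebra.induction with
        | grade0 r => exact freeD_algebraMap _ _ r
        | grade1 i => exact freeD_ι _ _ i
        | mul a b ha hb => simp [freeD_mul, ha, hb]
        | add a b ha hb => simp [ha, hb]
      rw [h, map_zero]

/-- The semifree DG algebra with the same generators, and with differential `∂ x_i = 0`,
`∂ r_j = 1`. -/
def unitRelations (R : Type u) [CommRing R] (n m : ℕ) : SemifreeDGA R :=
  ofRelations (fun _ : Fin m => (1 : FreeAlgebra R (Fin n)))

theorem d_ofRelations_x {n m : ℕ} (f : Fin m → FreeAlgebra R (Fin n)) (i : Fin n) :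
    (ofRelations f).d (FreeAlgebra.ι R (Sum.inl i)) = 0 := freeD_ι _ _ _

theorem d_ofRelations_r {n m : ℕ} (f : Fin m → FreeAlgebra R (Fin n)) (j : Fin m) :
    (ofRelations f).d (FreeAlgebra.ι R (Sum.inr j)) = relabel R Sum.inl (f j) := freeD_ι _ _ _

theorem d_unitRelations_x (n m : ℕ) (i : Fin n) :
    (unitRelations R n m).d (FreeAlgebra.ι R (Sum.inl i)) = 0 := freeD_ι _ _ _

theorem d_unitRelations_r (n m : ℕ) (j : Fin m) :
    (unitRelations R n m).d (FreeAlgebra.ι R (Sum.inr j)) = 1 :=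
  (freeD_ι _ _ _).trans (map_one _)

end SemifreeDGA

/-- The finitely presented algebra `R⟨x_1, …, x_n⟩ / (f_1, …, f_m)`. -/
abbrev PresentedAlgebra {R : Type u} [CommRing R] {n m : ℕ} (f : Fin m → FreeAlgebra R (Fin n)) :
    Type u :=
  (TwoSidedIdeal.span (Set.range f)).ringCon.Quotient

end DG

/-! All four conditions say that the unit of 𝒜 is a boundary. The boundaries in degree 0 form the
two-sided ideal generated by the `f j`, so the presented algebra vanishes exactly when 1 = ∂w for
some w, and w can then be chosen of degree 1 (`exists_d_eq_one`, `subsingleton_of_d_eq_one`). For ℬ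
this always holds, since m ≥ 1 and ∂r_j = 1.

If 1 = ∂w with w of degree 1, then ∂(wx) = x for every cycle x, in the algebra and in every DG
module over it. Hence the algebra is quasi-isomorphic to 0 and its derived category is trivial,
which gives (b) and (c). Conversely, exactness of the unit passes along quasi-isomorphisms. If D(𝒜)
is equivalent to the trivial category D(ℬ), then 𝒜 becomes isomorphic to 0 in D(𝒜), so H(𝒜) = 0 and
the class of 1 vanishes.

For (a), one stabilization in degree 1 suffices. Let e and t be the new generators, of degrees 2 and
1, with ∂e = t. When 1 = ∂w, the tame substitution r_j ↦ r_j + t f_j, t ↦ z, e ↦ e + tz, where z is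
t minus the image of w under r_j ↦ r_j + t f_j, carries the differential to a normal form that does
not depend on f: ∂t = 1, and all other generators are cycles (`exists_mem_tame_normalize`).
Comparing 𝒜 and ℬ with this common form gives a tame isomorphism. Conversely, tame isomorphisms and
stabilizations preserve exactness of the unit. -/

namespace DG

/-! ## Exactness of the unit -/

section FreeLemmas

variable {R : Type u} [CommRing R] {ι κ : Type}

theorem relabel_ι (g : ι → κ) (i : ι) :
    relabel R g (FreeAlgebra.ι R i) = FreeAlgebra.ι R (g i) := by
  simp [relabel]

theorem mem_wordGrading_zero (a : FreeAlgebra R ι) :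
    a ∈ wordGrading R (fun _ : ι => (0 : ℤ)) 0 := by
  induction a using FreeAlgebra.induction with
  | grade0 r => exact SetLike.algebraMap_mem_graded _ r
  | grade1 i => exact ι_mem_wordGrading _ i
  | mul a b ha hb => simpa using SetLike.mul_mem_graded ha hb
  | add a b ha hb => exact add_mem ha hb

/-- An algebra homomorphism that kills the differentials of the generators kills all boundaries. -/
theorem map_freeD_eq_zero {S : Type*} [Ring S] [Algebra R S] (deg : ι → ℤ)
    (dgen : ι → FreeAlgebra R ι) (π : FreeAlgebra R ι →ₐ[R] S) (h : ∀ i, π (dgen i) = 0)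
    (a : FreeAlgebra R ι) : π (freeD deg dgen a) = 0 := by
  induction a using FreeAlgebra.induction with
  | grade0 r => rw [freeD_algebraMap, map_zero]
  | grade1 i => rw [freeD_ι, h]
  | mul a b ha hb => rw [freeD_mul, map_add, map_mul, map_mul, ha, hb, zero_mul, mul_zero, add_zero]
  | add a b ha hb => rw [map_add, map_add, ha, hb, add_zero]

theorem freeD_zero (deg : ι → ℤ) (a : FreeAlgebra R ι) : freeD deg (fun _ => 0) a = 0 :=
  map_freeD_eq_zero deg _ (AlgHom.id R _) (fun _ => map_zero _) a

end FreeLemmas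

theorem subsingleton_presentedAlgebra_iff {R : Type u} [CommRing R] {n m : ℕ}
    (f : Fin m → FreeAlgebra R (Fin n)) :
    Subsingleton (PresentedAlgebra f) ↔ 1 ∈ TwoSidedIdeal.span (Set.range f) := by
  rw [TwoSidedIdeal.mem_iff, ← RingCon.eq]
  exact subsingleton_iff_zero_eq_one.symm.trans eq_comm

/-! ### Boundaries of degree zero and the presented algebra. -/

namespace SemifreeDGA

variable {R : Type u} [CommRing R] {n m : ℕ}

/-- The degrees of the generators of `ofRelations f`. -/
abbrev relDeg (n m : ℕ) : Fin n ⊕ Fin m → ℤ := Sum.elim (fun _ => 0) (fun _ => 1)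

/-- The differentials of the generators of `ofRelations f`. -/
abbrev relDgen (f : Fin m → FreeAlgebra R (Fin n)) :
    Fin n ⊕ Fin m → FreeAlgebra R (Fin n ⊕ Fin m) :=
  Sum.elim (fun _ => 0) (fun j => relabel R Sum.inl (f j))

/-- Polynomials in the x_i are cycles of degree 0, so by the Leibniz rule the p that are boundaries
of degree-1 elements form a two-sided ideal; it contains f_j = ∂r_j. The degree of the primitive is
recorded because both the contraction x ↦ wx and the substitution t ↦ t − w need it. -/
theorem exists_d_eq_of_mem_span (f : Fin m → FreeAlgebra R (Fin n)) {p : FreeAlgebra R (Fin n)}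
    (hp : p ∈ TwoSidedIdeal.span (Set.range f)) :
    ∃ w ∈ wordGrading R (relDeg n m) 1, freeD (relDeg n m) (relDgen f) w = relabel R Sum.inl p := by
  have h0 (a : FreeAlgebra R (Fin n)) :
      relabel R Sum.inl a ∈ wordGrading R (relDeg n m) 0 :=
    relabel_mem Sum.inl (fun _ => 0) _ (fun _ => rfl) (mem_wordGrading_zero a)
  have hd (a : FreeAlgebra R (Fin n)) : freeD (relDeg n m) (relDgen f) (relabel R Sum.inl a) = 0 := by
    refine (freeD_relabel Sum.inl (fun _ => 0) _ (fun _ => rfl) (fun _ => 0) _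
      (fun _ => (map_zero _).symm) a).trans ?_
    rw [freeD_zero, map_zero]
  let I : TwoSidedIdeal (FreeAlgebra R (Fin n)) := TwoSidedIdeal.mk'
    {p | ∃ w ∈ wordGrading R (relDeg n m) 1, freeD (relDeg n m) (relDgen f) w = relabel R Sum.inl p}
    ⟨0, zero_mem _, by simp⟩
    (by
      rintro _ _ ⟨v, hv, hv'⟩ ⟨w, hw, hw'⟩
      exact ⟨v + w, add_mem hv hw, by rw [map_add, map_add, hv', hw']⟩)
    (by
      rintro _ ⟨v, hv, hv'⟩
      exact ⟨-v, neg_mem hv, by rw [map_neg, map_neg, hv']⟩)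
    (by
      rintro a _ ⟨v, hv, hv'⟩
      refine ⟨relabel R Sum.inl a * v, by simpa using SetLike.mul_mem_graded (h0 a) hv, ?_⟩
      rw [freeD_leibniz _ _ _ _ (h0 a), hd, hv', map_mul]
      simp)
    (by
      rintro _ a ⟨v, hv, hv'⟩
      refine ⟨v * relabel R Sum.inl a, by simpa using SetLike.mul_mem_graded hv (h0 a), ?_⟩
      rw [freeD_mul, hd, hv', map_mul]
      simp)
  have hI : TwoSidedIdeal.span (Set.range f) ≤ I := by
    rw [TwoSidedIdeal.span_le]
    rintro _ ⟨j, rfl⟩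
    rw [TwoSidedIdeal.coe_mk']
    exact ⟨FreeAlgebra.ι R (Sum.inr j), ι_mem_wordGrading (relDeg n m) (Sum.inr j),
      freeD_ι _ _ _⟩
  simpa [I, TwoSidedIdeal.mem_mk'] using hI hp

theorem exists_d_eq_one (f : Fin m → FreeAlgebra R (Fin n))
    (hf : Subsingleton (PresentedAlgebra f)) :
    ∃ w ∈ wordGrading R (relDeg n m) 1, freeD (relDeg n m) (relDgen f) w = 1 := by
  obtain ⟨w, hw, h⟩ := exists_d_eq_of_mem_span f ((subsingleton_presentedAlgebra_iff f).1 hf)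
  exact ⟨w, hw, by rw [h, map_one]⟩

theorem subsingleton_of_d_eq_one (f : Fin m → FreeAlgebra R (Fin n))
    (h : ∃ w, freeD (relDeg n m) (relDgen f) w = 1) : Subsingleton (PresentedAlgebra f) := by
  obtain ⟨w, hw⟩ := h
  let q : FreeAlgebra R (Fin n) →ₐ[R] PresentedAlgebra f := RingCon.mkₐ R _
  -- This is the augmentation onto H_0: it kills every r_j and every ∂r_j = f_j, hence all
  -- boundaries, so 1 = ∂w maps to 0.
  let π : FreeAlgebra R (Fin n ⊕ Fin m) →ₐ[R] PresentedAlgebra f :=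
    FreeAlgebra.lift R (Sum.elim (fun i => q (FreeAlgebra.ι R i)) (fun _ => 0))
  have hπ (a : FreeAlgebra R (Fin n)) : π (relabel R Sum.inl a) = q a := by
    have : π.comp (relabel R Sum.inl) = q := by
      ext i
      simp [π, relabel]
    exact DFunLike.congr_fun this a
  have h0 : π (freeD (relDeg n m) (relDgen f) w) = 0 := by
    refine map_freeD_eq_zero _ _ π ?_ w
    rintro (i | j)
    · exact map_zero π
    · refine (hπ (f j)).trans ?_
      exact (RingCon.eq _).2 (TwoSidedIdeal.subset_span (Set.mem_range_self j))
  rw [hw, map_one] at h0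
  exact subsingleton_of_zero_eq_one h0.symm

theorem subsingleton_presentedAlgebra_one (hm : 1 ≤ m) :
    Subsingleton (PresentedAlgebra (fun _ : Fin m => (1 : FreeAlgebra R (Fin n)))) :=
  subsingleton_of_d_eq_one _ ⟨_, d_unitRelations_r n m ⟨0, hm⟩⟩

end SemifreeDGA

/-! ## Quasi-isomorphism -/

namespace DGAlgebra

variable {R : Type u} [CommRing R]

/-- The forward direction holds for any DG homomorphism. The backward one is injectivity on homology
applied to the class of the cycle 1. -/
theorem Hom.IsQuasiIso.exists_d_eq_one_iff {A B : DGAlgebra R} {f : Hom A B} (hf : f.IsQuasiIso) :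
    (∃ a, A.d a = 1) ↔ ∃ b, B.d b = 1 := by
  constructor
  · rintro ⟨a, ha⟩
    exact ⟨f.toAlgHom a, by rw [← f.map_d, ha, map_one]⟩
  · rintro ⟨b, hb⟩
    -- The Leibniz rule for 1 · 1 reads ∂1 = ∂1 + ∂1.
    have hA : A.d 1 = 0 := by
      have h := A.leibniz 0 1 1 (SetLike.one_mem_graded A.grading)
      simpa using h
    rw [IsQuasiIso, homologyMap_bijective_iff] at hf
    exact hf.1 1 hA ⟨b, hb.trans (map_one f.toAlgHom).symm⟩

theorem QuasiIsomorphic.exists_d_eq_one_iff {A B : DGAlgebra R} (h : QuasiIsomorphic A B) :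
    (∃ a, A.d a = 1) ↔ ∃ b, B.d b = 1 := by
  induction h with
  | rel A B h => exact h.choose_spec.exists_d_eq_one_iff
  | refl A => rfl
  | symm A B _ ih => exact ih.symm
  | trans A B C _ _ ih₁ ih₂ => exact ih₁.trans ih₂

/-- The zero DG algebra. -/
def zero (R : Type u) [CommRing R] : DGAlgebra R where
  carrier := PUnit.{u + 1}
  grading _ := (⊥ : Submodule R PUnit.{u + 1})
  gradedAlgebra :=
    { one_mem := rfl
      mul_mem := fun _ _ _ _ _ _ => rfl
      decompose' := fun _ =>
        DirectSum.of (fun _ : ℤ => (⊥ : Submodule R PUnit.{u + 1})) 0 ⟨PUnit.unit, rfl⟩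
      left_inv := fun _ => rfl
      right_inv := fun _ => DFinsupp.ext fun _ => Subsingleton.elim _ _ }
  d := 0
  d_mem _ _ _ := rfl
  d_d _ := rfl
  leibniz _ _ _ _ := rfl

theorem quasiIsomorphic_zero {A : DGAlgebra R} (h : ∃ w ∈ A.grading 1, A.d w = 1) :
    QuasiIsomorphic A (zero R) := by
  obtain ⟨w, hw, hd⟩ := h
  let π : Hom A (zero R) :=
    { toAlgHom := AlgHom.ofLinearMap (0 : A.carrier →ₗ[R] PUnit.{u + 1}) rfl (fun _ _ => rfl)
      map_mem := fun _ _ _ => rfl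
      map_d := fun _ => rfl }
  refine Relation.EqvGen.rel _ _ ⟨π, ?_⟩
  rw [Hom.IsQuasiIso, homologyMap_bijective_iff]
  -- Left multiplication by w is a contracting homotopy: ∂(wx) = x − w ∂x.
  refine ⟨fun x hx _ => ⟨w * x, ?_⟩, fun y _ => ⟨0, map_zero _, 0, rfl⟩⟩
  have hx' : A.d x = 0 := hx
  change A.d (w * x) = x
  rw [A.leibniz 1 w x hw, hd, hx']
  simp

end DGAlgebra
end DG
namespace DG

/-! ## Derived categories -/

namespace DGModule

variable {R : Type u} [CommRing R] {A : DGAlgebra R}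

/-- The zero DG module. -/
def zero (A : DGAlgebra R) : DGModule A where
  carrier := PUnit
  grading _ := ⊥
  isInternal := ⟨fun _ _ _ => DFinsupp.ext fun _ => Subsingleton.elim _ _, fun _ =>
    ⟨DirectSum.of (fun _ : ℤ => (⊥ : AddSubgroup PUnit.{u + 1})) 0 ⟨PUnit.unit, rfl⟩, rfl⟩⟩
  smul_mem _ _ _ _ _ _ := rfl
  d := 0
  d_mem _ _ _ := rfl
  d_d _ := rfl
  leibniz _ _ _ _ := rfl

/-- The morphism to the zero DG module. -/
def toZero (M : DGModule A) : M ⟶ zero A :=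
  (⟨0, fun _ _ _ => rfl, fun _ => rfl⟩ : Hom M (zero A))

theorem comp_toZero {M N : DGModule A} (f : M ⟶ N) : f ≫ toZero N = toZero M := rfl

/-- The DG algebra `A` as a left DG module over itself. -/
def self (A : DGAlgebra R) : DGModule A where
  carrier := A.carrier
  grading i := (A.grading i).toAddSubgroup
  isInternal := DirectSum.Decomposition.isInternal A.grading
  smul_mem _ _ _ _ ha hm := SetLike.mul_mem_graded ha hm
  d := A.d.toAddMonoidHom
  d_mem := A.d_mem
  d_d := A.d_d
  leibniz := A.leibniz

/-- The same homotopy, now acting on M, makes every DG module acyclic. -/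
theorem quasiIso_toZero (h : ∃ w ∈ A.grading 1, A.d w = 1) (M : DGModule A) :
    quasiIso A (toZero M) := by
  obtain ⟨w, hw, hd⟩ := h
  rw [quasiIso, homologyMap_bijective_iff]
  refine ⟨fun x hx _ => ⟨w • x, ?_⟩, fun y _ => ⟨0, map_zero _, 0, rfl⟩⟩
  rw [M.leibniz 1 w x hw, hd, hx]
  simp

/-- Total homology as a functor on DG modules. -/
def homologyFunctor (A : DGAlgebra R) : DGModule A ⥤ Type u where
  obj M := Homology M.d
  map f := TypeCat.ofHom (homologyMap _ _ (Hom.addHom f) (Hom.addHom_d f))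
  map_id M := by
    ext x
    obtain ⟨x, rfl⟩ := QuotientAddGroup.mk_surjective x
    rfl
  map_comp f g := by
    ext x
    obtain ⟨x, rfl⟩ := QuotientAddGroup.mk_surjective x
    rfl

end DGModule

namespace DerivedCat

variable {R : Type u} [CommRing R] {A : DGAlgebra R}

theorem nonempty_iso_zero (h : ∃ w ∈ A.grading 1, A.d w = 1) (X : DerivedCat A) :
    Nonempty (X ≅ (Q A).obj (DGModule.zero A)) := by
  obtain ⟨M, rfl⟩ := (Localization.Construction.objEquiv (DGModule.quasiIso A)).surjective X
  exact ⟨Localization.Construction.wIso _ (DGModule.quasiIso_toZero h M)⟩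

/-- That all objects are isomorphic does not bound the morphisms. The maps to the zero module form a
natural transformation from the identity to a constant functor. It extends to the localization,
where all its components are invertible; naturality then forces parallel morphisms to agree. -/
theorem subsingleton_hom (h : ∃ w ∈ A.grading 1, A.d w = 1) (X Y : DerivedCat A) :
    Subsingleton (X ⟶ Y) := by
  let τ : 𝟭 (DerivedCat A) ⟶ (Functor.const (DerivedCat A)).obj ((Q A).obj (DGModule.zero A)) :=
    Localization.Construction.natTransExtension
      { app := fun M => (Q A).map (DGModule.toZero M)
        naturality := fun M N f => by
          change (Q A).map f ≫ (Q A).map (DGModule.toZero N) = (Q A).map (DGModule.toZero M) ≫ 𝟙 _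
          rw [← Functor.map_comp, DGModule.comp_toZero, Category.comp_id] }
  have hτ (Y : DerivedCat A) : IsIso (τ.app Y) := by
    obtain ⟨M, rfl⟩ := (Localization.Construction.objEquiv (DGModule.quasiIso A)).surjective Y
    have : τ.app ((Q A).obj M) = (Q A).map (DGModule.toZero M) :=
      Localization.Construction.NatTransExtension.app_eq _ M
    change IsIso (τ.app ((Q A).obj M))
    rw [this]
    exact MorphismProperty.Q_inverts _ _ (DGModule.quasiIso_toZero h M)
  refine ⟨fun f g => ?_⟩
  have := hτ Y
  rw [← cancel_mono (τ.app Y)]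
  exact (τ.naturality f).trans (τ.naturality g).symm

/-- Homology inverts quasi-isomorphisms, so it descends to the derived category. The isomorphism
then gives H(A) ≅ H(0), a single point, and the class of 1 is zero. -/
theorem exists_d_eq_one_of_iso (h : Nonempty ((Q A).obj (DGModule.self A) ≅
    (Q A).obj (DGModule.zero A))) : ∃ w, A.d w = 1 := by
  obtain ⟨e⟩ := h
  let H : DerivedCat A ⥤ Type u := Localization.Construction.lift (DGModule.homologyFunctor A)
    (fun M N f hf => (isIso_iff_bijective _).2 hf)
  have eH : Homology (DGModule.self A).d ≃ Homology (DGModule.zero A).d := (H.mapIso e).toEquiv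
  have hA : A.d 1 = 0 := by
    have h := A.leibniz 0 1 1 (SetLike.one_mem_graded A.grading)
    simpa using h
  have h0 : Subsingleton (Homology (DGModule.zero A).d) := by
    refine ⟨fun x y => ?_⟩
    obtain ⟨x, rfl⟩ := QuotientAddGroup.mk_surjective x
    obtain ⟨y, rfl⟩ := QuotientAddGroup.mk_surjective y
    exact congrArg _ (Subtype.ext (Subsingleton.elim (α := PUnit) _ _))
  have h1 : (QuotientAddGroup.mk ⟨(1 : A.carrier), hA⟩ : Homology (DGModule.self A).d) = 0 :=
    eH.injective (Subsingleton.elim _ _)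
  exact (QuotientAddGroup.eq_zero_iff _).1 h1

end DerivedCat

/-! ### Derived Morita equivalence and exactness of the unit. -/

section Morita

variable {R : Type u} [CommRing R] {A B : DGAlgebra R}

/-- All objects of D(B) are isomorphic, in particular the images of A and of 0; a fully faithful
functor reflects this isomorphism. Only the underlying equivalence of categories matters. -/
theorem DerivedMoritaEquivalent.exists_d_eq_one (h : DerivedMoritaEquivalent A B)
    (hB : ∃ w ∈ B.grading 1, B.d w = 1) : ∃ w, A.d w = 1 := by
  obtain ⟨F, -, -⟩ := h
  obtain ⟨e⟩ := DerivedCat.nonempty_iso_zero hB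
    (F.functor.obj ((DerivedCat.Q A).obj (DGModule.self A)))
  obtain ⟨e'⟩ := DerivedCat.nonempty_iso_zero hB
    (F.functor.obj ((DerivedCat.Q A).obj (DGModule.zero A)))
  exact DerivedCat.exists_d_eq_one_of_iso ⟨F.functor.preimageIso (e ≪≫ e'.symm)⟩

theorem derivedMoritaEquivalent_of_d_eq_one (hA : ∃ w ∈ A.grading 1, A.d w = 1)
    (hB : ∃ w ∈ B.grading 1, B.d w = 1) : DerivedMoritaEquivalent A B := by
  have sA := DerivedCat.subsingleton_hom hA
  have sB := DerivedCat.subsingleton_hom hB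
  let zA := (DerivedCat.Q A).obj (DGModule.zero A)
  let zB := (DerivedCat.Q B).obj (DGModule.zero B)
  have iA (X : DerivedCat A) : X ≅ zA := (DerivedCat.nonempty_iso_zero hA X).some
  have iB (X : DerivedCat B) : X ≅ zB := (DerivedCat.nonempty_iso_zero hB X).some
  let F : DerivedCat A ≌ DerivedCat B :=
    { functor := (Functor.const _).obj zB
      inverse := (Functor.const _).obj zA
      unitIso := NatIso.ofComponents (fun X => iA X) (fun _ => Subsingleton.elim _ _)
      counitIso := NatIso.ofComponents (fun X => (iB X).symm) (fun _ => Subsingleton.elim _ _)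
      functor_unitIso_comp := fun _ => Subsingleton.elim _ _ }
  refine ⟨F, NatIso.ofComponents (fun X => (iB _).symm) (fun _ => Subsingleton.elim _ _), ?_⟩
  intro X Y Z f g h _
  -- In D(B) any two objects are isomorphic and every diagram commutes, so every triangle is
  -- isomorphic to the cone triangle of the identity of 0.
  exact ⟨DGModule.zero B, DGModule.zero B, 𝟙 _, iB _, iB _,
    iB _ ≪≫ (iB _).symm, Subsingleton.elim _ _, Subsingleton.elim _ _, Subsingleton.elim _ _⟩

end Morita
end DG
namespace DG

/-! ## Homomorphisms of free algebras -/

section FreeHom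

variable {R : Type u} [CommRing R] {ι κ : Type}

theorem map_mem_wordGrading (φ : FreeAlgebra R ι →ₐ[R] FreeAlgebra R κ) (deg : ι → ℤ)
    (deg' : κ → ℤ) (h : ∀ i, φ (FreeAlgebra.ι R i) ∈ wordGrading R deg' (deg i)) {k : ℤ}
    {a : FreeAlgebra R ι} (ha : a ∈ wordGrading R deg k) : φ a ∈ wordGrading R deg' k := by
  induction ha using Submodule.span_induction with
  | mem a ha =>
    obtain ⟨w, rfl, rfl⟩ := ha
    induction w with
    | nil => simpa using SetLike.one_mem_graded (wordGrading R deg')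
    | cons i w ih =>
      simp only [List.map_cons, List.prod_cons, List.sum_cons, map_mul]
      exact SetLike.mul_mem_graded (h i) ih
  | zero => rw [map_zero]; exact zero_mem _
  | add a b _ _ iha ihb => rw [map_add]; exact add_mem iha ihb
  | smul r a _ iha => rw [map_smul]; exact Submodule.smul_mem _ r iha

/-- Compatibility with differentials may be checked on generators: preservation of degree makes φ
commute with the signs in the Leibniz rule. -/
theorem map_freeD (φ : FreeAlgebra R ι →ₐ[R] FreeAlgebra R κ) (deg : ι → ℤ) (deg' : κ → ℤ)
    (h : ∀ i, φ (FreeAlgebra.ι R i) ∈ wordGrading R deg' (deg i))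
    (dgen : ι → FreeAlgebra R ι) (dgen' : κ → FreeAlgebra R κ)
    (hd : ∀ i, φ (dgen i) = freeD deg' dgen' (φ (FreeAlgebra.ι R i))) (a : FreeAlgebra R ι) :
    φ (freeD deg dgen a) = freeD deg' dgen' (φ a) := by
  have hs (a : FreeAlgebra R ι) : freeSign R deg' (φ a) = φ (freeSign R deg a) := by
    have : (freeSign R deg').comp φ = φ.comp (freeSign R deg) := by
      ext i
      simp [freeSign_of_mem deg' (h i), freeSign_of_mem deg (ι_mem_wordGrading deg i),
        Units.smul_def]
    exact DFunLike.congr_fun this a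
  induction a using FreeAlgebra.induction with
  | grade0 r => simp [freeD_algebraMap]
  | grade1 i => rw [freeD_ι, hd]
  | mul a b ha hb => simp only [map_mul, freeD_mul, map_add, ha, hb, hs]
  | add a b ha hb => simp only [map_add, ha, hb]

theorem map_eq_self_of_mem_adjoin {s : Set ι} {φ : FreeAlgebra R ι →ₐ[R] FreeAlgebra R ι}
    (h : ∀ j ∈ s, φ (FreeAlgebra.ι R j) = FreeAlgebra.ι R j) {P : FreeAlgebra R ι}
    (hP : P ∈ Algebra.adjoin R (FreeAlgebra.ι R '' s)) : φ P = P := by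
  have h' : Set.EqOn φ (AlgHom.id R _) (FreeAlgebra.ι R '' s) := by
    rintro _ ⟨j, hj, rfl⟩
    exact h j hj
  exact AlgHom.eqOn_adjoin_iff.2 h' hP

theorem relabel_mem_adjoin (g : ι → κ) {s : Set κ} (h : ∀ i, g i ∈ s) (a : FreeAlgebra R ι) :
    relabel R g a ∈ Algebra.adjoin R (FreeAlgebra.ι R '' s) := by
  induction a using FreeAlgebra.induction with
  | grade0 r => rw [AlgHom.commutes]; exact Subalgebra.algebraMap_mem _ r
  | grade1 i => rw [relabel_ι]; exact Algebra.subset_adjoin ⟨_, h i, rfl⟩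
  | mul a b ha hb => rw [map_mul]; exact mul_mem ha hb
  | add a b ha hb => rw [map_add]; exact add_mem ha hb

theorem map_relabel_eq_self (g : ι → κ) {φ : FreeAlgebra R κ →ₐ[R] FreeAlgebra R κ}
    (h : ∀ i, φ (FreeAlgebra.ι R (g i)) = FreeAlgebra.ι R (g i)) (a : FreeAlgebra R ι) :
    φ (relabel R g a) = relabel R g a :=
  map_eq_self_of_mem_adjoin (s := Set.range g) (by rintro _ ⟨i, rfl⟩; exact h i)
    (relabel_mem_adjoin g Set.mem_range_self a)

theorem relabel_relabel {μ : Type} (g : ι → κ) (h : κ → μ) (a : FreeAlgebra R ι) :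
    relabel R h (relabel R g a) = relabel R (h ∘ g) a := by
  have : (relabel R h).comp (relabel R g) = relabel R (h ∘ g) := by
    ext i
    simp [relabel]
  exact DFunLike.congr_fun this a

theorem relabel_id (a : FreeAlgebra R ι) : relabel R id a = a :=
  map_eq_self_of_mem_adjoin (s := Set.univ) (fun j _ => relabel_ι id j) (by simp)

theorem relabel_bijective (σ : ι ≃ κ) : Function.Bijective (relabel R σ) := by
  refine Function.bijective_iff_has_inverse.2 ⟨relabel R σ.symm, fun a => ?_, fun a => ?_⟩
  · rw [relabel_relabel, Equiv.symm_comp_self, relabel_id]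
  · rw [relabel_relabel, Equiv.self_comp_symm, relabel_id]

end FreeHom

namespace SemifreeDGA

variable {R : Type u} [CommRing R]

/-! ## Stable tame isomorphisms preserve exactness of the unit -/

theorem TameIsomorphic.exists_d_eq_one {A B : SemifreeDGA R} (h : TameIsomorphic A B)
    (hB : ∃ b, B.d b = 1) : ∃ a, A.d a = 1 := by
  obtain ⟨φ, -, σ, -, hd⟩ := h
  obtain ⟨b, hb⟩ := hB
  obtain ⟨c, rfl⟩ := (relabel_bijective σ).2 b
  obtain ⟨a, rfl⟩ := φ.surjective c
  refine ⟨a, φ.injective ((relabel_bijective σ).1 ?_)⟩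
  rw [hd, hb, map_one, map_one]

theorem exists_d_stabilize_eq_one_iff (A : SemifreeDGA R) (k : ℤ) :
    (∃ a, (A.stabilize k).d a = 1) ↔ ∃ a, A.d a = 1 := by
  constructor
  · rintro ⟨a, ha⟩
    -- Killing both stabilizing generators is compatible with the differentials because ∂e = f also
    -- maps to 0. It retracts the inclusion of A used in the converse.
    let ρ : FreeAlgebra R (A.ι ⊕ Bool) →ₐ[R] FreeAlgebra R A.ι :=
      FreeAlgebra.lift R (Sum.elim (FreeAlgebra.ι R) (fun _ => 0))
    have hρ (i : A.ι) : ρ (FreeAlgebra.ι R (Sum.inl i)) = FreeAlgebra.ι R i := by simp [ρ]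
    have hρ' (b : Bool) : ρ (FreeAlgebra.ι R (Sum.inr b)) = 0 := by simp [ρ]
    have hρ'' (a : FreeAlgebra R A.ι) : ρ (relabel R Sum.inl a) = a := by
      have : ρ.comp (relabel R Sum.inl) = AlgHom.id R _ := by
        ext i
        simp [ρ, relabel]
      exact DFunLike.congr_fun this a
    refine ⟨ρ a, ?_⟩
    refine ((map_freeD ρ (A.stabilize k).deg A.deg ?_ (A.stabilize k).dgen A.dgen ?_ a).symm.trans
      (congrArg ρ ha)).trans (map_one ρ)
    · rintro (i | b)
      · exact (hρ i).symm ▸ ι_mem_wordGrading A.deg i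
      · exact (hρ' b).symm ▸ zero_mem _
    · rintro (i | _ | _)
      · refine (hρ'' (A.dgen i)).trans ?_
        rw [hρ, freeD_ι]
      · refine (map_zero ρ).trans ?_
        rw [hρ', map_zero]
      · refine (hρ' false).trans ?_
        rw [hρ', map_zero]
  · rintro ⟨a, ha⟩
    refine ⟨relabel R Sum.inl a, ?_⟩
    refine (freeD_relabel Sum.inl A.deg _ (fun _ => rfl) A.dgen _ (fun _ => rfl) a).trans ?_
    exact (congrArg _ ha).trans (map_one _)

theorem exists_d_foldl_stabilize_eq_one_iff (ks : List ℤ) (A : SemifreeDGA R) :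
    (∃ a, (ks.foldl stabilize A).d a = 1) ↔ ∃ a, A.d a = 1 := by
  induction ks generalizing A with
  | nil => rfl
  | cons k ks ih => exact (ih _).trans (exists_d_stabilize_eq_one_iff A k)

theorem StableTameIsomorphic.exists_d_eq_one {A B : SemifreeDGA R} (h : StableTameIsomorphic A B)
    (hB : ∃ b, B.d b = 1) : ∃ a, A.d a = 1 := by
  obtain ⟨ks, ls, h⟩ := h
  exact (exists_d_foldl_stabilize_eq_one_iff ks A).1
    (h.exists_d_eq_one ((exists_d_foldl_stabilize_eq_one_iff ls B).2 hB))

/-! ## Tame automorphisms -/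

section Tame

variable {ι : Type}

/-- The monoid of tame automorphisms, generated by the elementary ones. -/
abbrev tame (R : Type u) [CommRing R] (deg : ι → ℤ) :
    Submonoid (FreeAlgebra R ι ≃ₐ[R] FreeAlgebra R ι) :=
  Submonoid.closure {φ | IsElementary deg φ}

/-- Since P does not involve x_i, φ fixes P, and the inverse sends x_i to α⁻¹ x_i − α⁻¹ P. -/
theorem IsElementary.inv {deg : ι → ℤ} {φ : FreeAlgebra R ι ≃ₐ[R] FreeAlgebra R ι}
    (h : IsElementary deg φ) : IsElementary deg φ⁻¹ := by
  obtain ⟨i, α, P, hP, hP', hi, hj⟩ := h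
  have hφP : φ P = P := map_eq_self_of_mem_adjoin (φ := φ.toAlgHom) (fun j h => hj j h) hP'
  refine ⟨i, α⁻¹, -((↑α⁻¹ : R) • P), neg_mem (Submodule.smul_mem _ _ hP),
    neg_mem (Subalgebra.smul_mem _ hP' _), ?_, fun j h => ?_⟩
  · refine (AlgEquiv.symm_apply_eq φ).2 ?_
    rw [map_add, map_neg, map_smul, map_smul, hi, hφP, smul_add, smul_smul, Units.inv_mul, one_smul]
    abel
  · exact (AlgEquiv.symm_apply_eq φ).2 (hj j h).symm

theorem inv_mem_tame {deg : ι → ℤ} {φ : FreeAlgebra R ι ≃ₐ[R] FreeAlgebra R ι}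
    (h : φ ∈ tame R deg) : φ⁻¹ ∈ tame R deg := by
  induction h using Submonoid.closure_induction with
  | mem φ h => exact Submonoid.subset_closure (IsElementary.inv h)
  | one => rw [inv_one]; exact one_mem _
  | mul φ ψ _ _ h h' => rw [mul_inv_rev]; exact mul_mem h' h

/-- The substitution `x_i ↦ x_i + P` is tame. -/
theorem exists_mem_tame_add (deg : ι → ℤ) (i : ι) {P : FreeAlgebra R ι}
    (hP : P ∈ wordGrading R deg (deg i))
    (hP' : P ∈ Algebra.adjoin R (FreeAlgebra.ι R '' {j | j ≠ i})) :
    ∃ φ ∈ tame R deg, φ (FreeAlgebra.ι R i) = FreeAlgebra.ι R i + P ∧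
      ∀ j, j ≠ i → φ (FreeAlgebra.ι R j) = FreeAlgebra.ι R j := by
  classical
  let s (Q : FreeAlgebra R ι) : FreeAlgebra R ι →ₐ[R] FreeAlgebra R ι :=
    FreeAlgebra.lift R (fun j => if j = i then FreeAlgebra.ι R i + Q else FreeAlgebra.ι R j)
  have hs (Q) : s Q (FreeAlgebra.ι R i) = FreeAlgebra.ι R i + Q := by simp [s]
  have hs' (Q j) (h : j ≠ i) : s Q (FreeAlgebra.ι R j) = FreeAlgebra.ι R j := by simp [s, h]
  have hs'' (Q) : s Q P = P := map_eq_self_of_mem_adjoin (fun j h => hs' Q j h) hP'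
  -- The substitutions by P and −P both fix P, hence are mutually inverse.
  let φ : FreeAlgebra R ι ≃ₐ[R] FreeAlgebra R ι := AlgEquiv.ofAlgHom (s P) (s (-P))
    (by
      ext j
      by_cases h : j = i
      · subst h; simp [hs, hs'']
      · simp [hs' _ j h])
    (by
      ext j
      by_cases h : j = i
      · subst h; simp [hs, hs'']
      · simp [hs' _ j h])
  exact ⟨φ, Submonoid.subset_closure ⟨i, 1, P, hP, hP', (hs P).trans (by rw [Units.val_one, one_smul]),
    hs' P⟩, hs P, hs' P⟩

end Tame

/-! ## The normal form -/

section NormalForm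

variable {n m : ℕ}

/-- The degrees of the generators of the stabilization of `ofRelations f` in degree `1`. -/
abbrev stabDeg (n m : ℕ) : (Fin n ⊕ Fin m) ⊕ Bool → ℤ :=
  Sum.elim (relDeg n m) (fun b => if b then 1 + 1 else 1)

/-- The differentials of the generators of the stabilization of `ofRelations f` in degree `1`. -/
abbrev stabDgen (f : Fin m → FreeAlgebra R (Fin n)) :
    (Fin n ⊕ Fin m) ⊕ Bool → FreeAlgebra R ((Fin n ⊕ Fin m) ⊕ Bool) :=
  Sum.elim (fun i => relabel R Sum.inl (relDgen f i))
    (fun b => if b then FreeAlgebra.ι R (Sum.inr false) else 0)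

/-- Differentials of generators that vanish except that the stabilizing generator of degree `1` is
sent to `1`. -/
abbrev normalDgen (R : Type u) [CommRing R] (n m : ℕ) :
    (Fin n ⊕ Fin m) ⊕ Bool → FreeAlgebra R ((Fin n ⊕ Fin m) ⊕ Bool) :=
  Sum.elim (fun _ => 0) (fun b => if b then 0 else 1)

/-- The substitution `r_j ↦ r_j + t p_j`, where `t` is the stabilizing generator of degree `1`. -/
theorem exists_mem_tame_add_mul (p : Fin m → FreeAlgebra R (Fin n)) :
    ∃ φ ∈ tame R (stabDeg n m),
      (∀ i, φ (FreeAlgebra.ι R (Sum.inl (Sum.inl i))) = FreeAlgebra.ι R (Sum.inl (Sum.inl i))) ∧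
      (∀ j, φ (FreeAlgebra.ι R (Sum.inl (Sum.inr j))) = FreeAlgebra.ι R (Sum.inl (Sum.inr j)) +
        FreeAlgebra.ι R (Sum.inr false) * relabel R (Sum.inl ∘ Sum.inl) (p j)) ∧
      ∀ b, φ (FreeAlgebra.ι R (Sum.inr b)) = FreeAlgebra.ι R (Sum.inr b) := by
  classical
  -- An elementary automorphism moves a single generator, so the r_j are changed one at a time.
  suffices h : ∀ s : Finset (Fin m), ∃ φ ∈ tame R (stabDeg n m),
      (∀ i, φ (FreeAlgebra.ι R (Sum.inl (Sum.inl i))) = FreeAlgebra.ι R (Sum.inl (Sum.inl i))) ∧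
      (∀ j, φ (FreeAlgebra.ι R (Sum.inl (Sum.inr j))) = FreeAlgebra.ι R (Sum.inl (Sum.inr j)) +
        if j ∈ s then FreeAlgebra.ι R (Sum.inr false) * relabel R (Sum.inl ∘ Sum.inl) (p j)
        else 0) ∧
      ∀ b, φ (FreeAlgebra.ι R (Sum.inr b)) = FreeAlgebra.ι R (Sum.inr b) by
    simpa using h Finset.univ
  intro s
  induction s using Finset.induction_on with
  | empty => exact ⟨1, one_mem _, by simp, by simp, by simp⟩
  | insert k s hk ih =>
    obtain ⟨φ, hφ, hx, hr, hb⟩ := ih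
    obtain ⟨ψ, hψ, hk', hψ'⟩ := exists_mem_tame_add (R := R) (stabDeg n m) (Sum.inl (Sum.inr k))
      (P := FreeAlgebra.ι R (Sum.inr false) * relabel R (Sum.inl ∘ Sum.inl) (p k))
      (by
        have h := SetLike.mul_mem_graded (ι_mem_wordGrading (R := R) (stabDeg n m) (Sum.inr false))
          (relabel_mem (Sum.inl ∘ Sum.inl) (fun _ => 0) (stabDeg n m) (fun _ => rfl)
            (mem_wordGrading_zero (p k)))
        simpa using h)
      (mul_mem (Algebra.subset_adjoin ⟨_, by simp, rfl⟩)
        (relabel_mem_adjoin _ (by simp) _))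
    have hrel (a : FreeAlgebra R (Fin n)) : ψ (relabel R (Sum.inl ∘ Sum.inl) a) =
        relabel R (Sum.inl ∘ Sum.inl) a :=
      map_relabel_eq_self (φ := ψ.toAlgHom) _ (fun i => hψ' _ (by simp)) a
    -- The product applies φ first. The terms t p_j that φ has added involve only t and the x_i,
    -- which ψ fixes.
    refine ⟨ψ * φ, mul_mem hψ hφ, fun i => ?_, fun j => ?_, fun b => ?_⟩
    · rw [AlgEquiv.mul_apply, hx, hψ' _ (by simp)]
    · rw [AlgEquiv.mul_apply, hr]
      by_cases hj : j = k
      · subst hj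
        simp [hk, hk']
      · have h1 := hψ' (Sum.inl (Sum.inr j)) (by simpa using hj)
        have h2 := hψ' (Sum.inr false) (by simp)
        by_cases hjs : j ∈ s
        · simp [hjs, h1, h2, hrel]
        · simp [hjs, hj, h1]
    · rw [AlgEquiv.mul_apply, hb, hψ' _ (by simp)]

/-- Write t and e for the stabilizing generators and D for the normal differential, so that D(ta) =
a − t Da. Then D(r_j + t f_j) = f_j. If z is a cycle for D, then D(e + tz) = z, so e ↦ e + tz and t
↦ z respect ∂e = t. It remains to find a cycle z = t − (terms) for which the substitution is tame,
and w supplies it. -/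
theorem exists_mem_tame_normalize (f : Fin m → FreeAlgebra R (Fin n))
    (h : ∃ w ∈ wordGrading R (relDeg n m) 1, freeD (relDeg n m) (relDgen f) w = 1) :
    ∃ φ ∈ tame R (stabDeg n m), ∀ a, φ (freeD (stabDeg n m) (stabDgen f) a) =
      freeD (stabDeg n m) (normalDgen R n m) (φ a) := by
  obtain ⟨w, hw, hdw⟩ := h
  let t : FreeAlgebra R ((Fin n ⊕ Fin m) ⊕ Bool) := FreeAlgebra.ι R (Sum.inr false)
  let F : FreeAlgebra R (Fin n) →ₐ[R] FreeAlgebra R ((Fin n ⊕ Fin m) ⊕ Bool) :=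
    relabel R (Sum.inl ∘ Sum.inl)
  -- Elements of S do not involve e: they may be added to e by an elementary automorphism, which
  -- then fixes them.
  let S : Subalgebra R (FreeAlgebra R ((Fin n ⊕ Fin m) ⊕ Bool)) :=
    Algebra.adjoin R (FreeAlgebra.ι R '' {j | j ≠ Sum.inr true})
  let W : FreeAlgebra R ((Fin n ⊕ Fin m) ⊕ Bool) := relabel R Sum.inl w
  let D := freeD (stabDeg n m) (normalDgen R n m)
  have ht : t ∈ wordGrading R (stabDeg n m) 1 :=
    ι_mem_wordGrading (R := R) (stabDeg n m) (Sum.inr false)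
  have htS : t ∈ S := Algebra.subset_adjoin ⟨_, by simp, rfl⟩
  have hF (a) : F a ∈ wordGrading R (stabDeg n m) 0 :=
    relabel_mem (Sum.inl ∘ Sum.inl) (fun _ => 0) (stabDeg n m) (fun _ => rfl)
      (mem_wordGrading_zero a)
  have hFS (a) : F a ∈ S := relabel_mem_adjoin _ (by simp) _
  have hDF (a) : D (F a) = 0 := by
    refine (freeD_relabel (Sum.inl ∘ Sum.inl) (fun _ => 0) (stabDeg n m) (fun _ => rfl)
      (fun _ => 0) (normalDgen R n m) (fun _ => (map_zero _).symm) a).trans ?_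
    rw [freeD_zero, map_zero]
  have hDι (i) : D (FreeAlgebra.ι R i) = normalDgen R n m i := freeD_ι _ _ _
  have hDt (a) : D (t * a) = a - t * D a := by
    refine (freeD_leibniz _ _ _ _ ht).trans ?_
    rw [show freeD (stabDeg n m) (normalDgen R n m) t = 1 from freeD_ι _ _ _]
    simp [sub_eq_add_neg, D]
  have hW : W ∈ wordGrading R (stabDeg n m) 1 :=
    relabel_mem Sum.inl (relDeg n m) (stabDeg n m) (fun _ => rfl) hw
  have htF (a) : t * F a ∈ wordGrading R (stabDeg n m) 1 := by
    simpa using SetLike.mul_mem_graded ht (hF a)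
  -- This is t ↦ t − w, elementary because w involves only the x_i and r_j.
  obtain ⟨φ₁, hφ₁, h₁, h₁'⟩ := exists_mem_tame_add (R := R) (stabDeg n m) (Sum.inr false)
    (P := -W) (neg_mem hW) (neg_mem (relabel_mem_adjoin _ (by simp) _))
  obtain ⟨φ₂, hφ₂, h₂x, h₂r, h₂b⟩ := exists_mem_tame_add_mul f
  have h₂F (a) : φ₂ (F a) = F a := map_relabel_eq_self (φ := φ₂.toAlgHom) _ h₂x a
  have h₂deg (i) : φ₂ (FreeAlgebra.ι R i) ∈ wordGrading R (stabDeg n m) (stabDeg n m i) := by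
    rcases i with (i | j) | b
    · rw [h₂x]; exact ι_mem_wordGrading (stabDeg n m) _
    · rw [h₂r]; exact add_mem (ι_mem_wordGrading (stabDeg n m) (Sum.inl (Sum.inr j))) (htF _)
    · rw [h₂b]; exact ι_mem_wordGrading (stabDeg n m) _
  have h₂S {a} (ha : a ∈ S) : φ₂ a ∈ S := by
    have : S ≤ S.comap φ₂.toAlgHom := by
      refine Algebra.adjoin_le ?_
      rintro _ ⟨(i | j) | b, hi, rfl⟩
      · change φ₂ _ ∈ S
        rw [h₂x]
        exact Algebra.subset_adjoin ⟨_, hi, rfl⟩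
      · change φ₂ _ ∈ S
        rw [h₂r]
        exact add_mem (Algebra.subset_adjoin ⟨_, hi, rfl⟩) (mul_mem htS (hFS _))
      · change φ₂ _ ∈ S
        rw [h₂b]
        exact Algebra.subset_adjoin ⟨_, hi, rfl⟩
    exact this ha
  have hDr (j) : D (FreeAlgebra.ι R (Sum.inl (Sum.inr j)) + t * F (f j)) = F (f j) := by
    rw [map_add, hDt, hDF, show D (FreeAlgebra.ι R (Sum.inl (Sum.inr j))) = 0 from freeD_ι _ _ _]
    simp
  -- φ₂ carries the auxiliary differential ∂r_j = f_j, ∂t = 1, ∂x_i = ∂e = 0 to D. On words in the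
  -- x_i and r_j the auxiliary differential is that of `ofRelations f`, so it sends W to 1.
  have hDW : D (φ₂ W) = 1 := by
    have h := map_freeD φ₂.toAlgHom (stabDeg n m) (stabDeg n m) h₂deg
      (Sum.elim (fun i => relabel R Sum.inl (relDgen f i)) (fun b => if b then 0 else 1))
      (normalDgen R n m) (by
        rintro ((i | j) | _ | _)
        · change φ₂ (relabel R Sum.inl 0) = D (φ₂ _)
          rw [map_zero, map_zero, h₂x]
          exact (hDι (Sum.inl (Sum.inl i))).symm
        · change φ₂ (relabel R Sum.inl (relabel R Sum.inl (f j))) = D (φ₂ _)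
          rw [relabel_relabel, h₂r]
          exact (h₂F _).trans (hDr j).symm
        · change φ₂ 1 = D (φ₂ _)
          rw [map_one, h₂b]
          exact (hDι (Sum.inr false)).symm
        · change φ₂ 0 = D (φ₂ _)
          rw [map_zero, h₂b]
          exact (hDι (Sum.inr true)).symm) W
    refine h.symm.trans ?_
    rw [freeD_relabel Sum.inl (relDeg n m) (stabDeg n m) (fun _ => rfl) (relDgen f) _
      (fun _ => rfl) w, hdw, map_one, map_one]
  -- This is the image of t under φ₂ ∘ φ₁; it is a cycle because D t and D(φ₂ W) are both 1.
  let z := t - φ₂ W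
  have hz : z ∈ wordGrading R (stabDeg n m) 1 :=
    sub_mem ht (map_mem_wordGrading φ₂.toAlgHom _ _ h₂deg hW)
  have hzS : z ∈ S := sub_mem htS (h₂S (relabel_mem_adjoin _ (by simp) _))
  have hDz : D z = 0 := by
    rw [map_sub, hDW, show D t = 1 from freeD_ι _ _ _, sub_self]
  have htz : t * z ∈ wordGrading R (stabDeg n m) (1 + 1) := SetLike.mul_mem_graded ht hz
  obtain ⟨φ₃, hφ₃, h₃, h₃'⟩ := exists_mem_tame_add (R := R) (stabDeg n m) (Sum.inr true)
    (P := t * z) htz (mul_mem htS hzS)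
  have h₃S {a} (ha : a ∈ S) : φ₃ a = a :=
    map_eq_self_of_mem_adjoin (φ := φ₃.toAlgHom) (fun j hj => h₃' j hj) ha
  let φ := φ₃ * (φ₂ * φ₁)
  have hφ (a) : φ a = φ₃ (φ₂ (φ₁ a)) := rfl
  have hx (i) : φ (FreeAlgebra.ι R (Sum.inl (Sum.inl i))) =
      FreeAlgebra.ι R (Sum.inl (Sum.inl i)) := by
    rw [hφ, h₁' _ (by simp), h₂x, h₃' _ (by simp)]
  have hr (j) : φ (FreeAlgebra.ι R (Sum.inl (Sum.inr j))) =
      FreeAlgebra.ι R (Sum.inl (Sum.inr j)) + t * F (f j) := by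
    rw [hφ, h₁' _ (by simp), h₂r, map_add, h₃' _ (by simp), h₃S (mul_mem htS (hFS _))]
  have hf : φ (FreeAlgebra.ι R (Sum.inr false)) = z := by
    rw [hφ, h₁, map_add, map_neg, h₂b, ← sub_eq_add_neg]
    exact h₃S hzS
  have he : φ (FreeAlgebra.ι R (Sum.inr true)) = FreeAlgebra.ι R (Sum.inr true) + t * z := by
    rw [hφ, h₁' _ (by simp), h₂b, h₃]
  refine ⟨φ, mul_mem hφ₃ (mul_mem hφ₂ hφ₁), map_freeD φ.toAlgHom _ _ ?_ _ _ ?_⟩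
  · rintro ((i | j) | _ | _)
    · exact (hx i).symm ▸ ι_mem_wordGrading (stabDeg n m) _
    · exact (hr j).symm ▸
        add_mem (ι_mem_wordGrading (stabDeg n m) (Sum.inl (Sum.inr j))) (htF _)
    · exact hf.symm ▸ hz
    · exact he.symm ▸ add_mem (ι_mem_wordGrading (stabDeg n m) (Sum.inr true)) htz
  · rintro ((i | j) | _ | _)
    · change φ (relabel R Sum.inl 0) = D (φ _)
      rw [map_zero, map_zero, hx]
      exact (hDι (Sum.inl (Sum.inl i))).symm
    · change φ (relabel R Sum.inl (relabel R Sum.inl (f j))) = D (φ _)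
      rw [relabel_relabel, hr, hDr]
      exact map_relabel_eq_self (φ := φ.toAlgHom) _ hx _
    · change φ 0 = D (φ _)
      rw [map_zero, hf, hDz]
    · change φ (FreeAlgebra.ι R (Sum.inr false)) = D (φ _)
      rw [hf, he, map_add, hDt, hDz, show D (FreeAlgebra.ι R (Sum.inr true)) = 0 from freeD_ι _ _ _]
      simp

theorem stableTameIsomorphic_of_d_eq_one (f g : Fin m → FreeAlgebra R (Fin n))
    (hf : ∃ w ∈ wordGrading R (relDeg n m) 1, freeD (relDeg n m) (relDgen f) w = 1)
    (hg : ∃ w ∈ wordGrading R (relDeg n m) 1, freeD (relDeg n m) (relDgen g) w = 1) :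
    StableTameIsomorphic (ofRelations f) (ofRelations g) := by
  obtain ⟨φ, hφ, hφd⟩ := exists_mem_tame_normalize f hf
  obtain ⟨ψ, hψ, hψd⟩ := exists_mem_tame_normalize g hg
  have key (a : FreeAlgebra R ((Fin n ⊕ Fin m) ⊕ Bool)) :
      ψ.symm (φ (freeD (stabDeg n m) (stabDgen f) a)) =
        freeD (stabDeg n m) (stabDgen g) (ψ.symm (φ a)) := by
    rw [AlgEquiv.symm_apply_eq, hφd, hψd, AlgEquiv.apply_symm_apply]
  -- Stabilizing in degree 1 gives t the degree of w. The normal form is the same for f and g, so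
  -- going to it by φ and back by ψ⁻¹ intertwines the two differentials.
  refine ⟨[1], [1], ψ⁻¹ * φ, mul_mem (inv_mem_tame hψ) hφ, Equiv.refl _, fun _ => rfl, fun a => ?_⟩
  change relabel R id (ψ.symm (φ (freeD (stabDeg n m) (stabDgen f) a))) =
    freeD (stabDeg n m) (stabDgen g) (relabel R id (ψ.symm (φ a)))
  rw [relabel_id, relabel_id]
  exact key a

end NormalForm

end SemifreeDGA
end DG

/-! ### The four equivalent conditions. -/

theorem proposition3p2 {R : Type u} [CommRing R] (n m : ℕ) (hm : 1 ≤ m)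
    (f : Fin m → FreeAlgebra R (Fin n)) :
    List.TFAE [
      DG.SemifreeDGA.StableTameIsomorphic
        (DG.SemifreeDGA.ofRelations f) (DG.SemifreeDGA.unitRelations R n m),
      DG.DGAlgebra.QuasiIsomorphic
        (DG.SemifreeDGA.ofRelations f).toDGAlgebra
        (DG.SemifreeDGA.unitRelations R n m).toDGAlgebra,
      DG.DerivedMoritaEquivalent
        (DG.SemifreeDGA.ofRelations f).toDGAlgebra
        (DG.SemifreeDGA.unitRelations R n m).toDGAlgebra,
      Subsingleton (DG.PresentedAlgebra f)] := by
  -- The unit of ℬ is the boundary of a degree-1 element; every implication below compares 𝒜 with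
  -- this fact.
  have hB := DG.SemifreeDGA.exists_d_eq_one (R := R) (n := n) _
    (DG.SemifreeDGA.subsingleton_presentedAlgebra_one hm)
  have hB' : ∃ w, (DG.SemifreeDGA.unitRelations R n m).d w = 1 := hB.imp fun _ h => h.2
  tfae_have 4 → 1 := fun h =>
    DG.SemifreeDGA.stableTameIsomorphic_of_d_eq_one f _ (DG.SemifreeDGA.exists_d_eq_one f h) hB
  tfae_have 4 → 2 := fun h =>
    .trans _ _ _ (DG.DGAlgebra.quasiIsomorphic_zero (DG.SemifreeDGA.exists_d_eq_one f h))
      (.symm _ _ (DG.DGAlgebra.quasiIsomorphic_zero hB))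
  tfae_have 4 → 3 := fun h =>
    DG.derivedMoritaEquivalent_of_d_eq_one (DG.SemifreeDGA.exists_d_eq_one f h) hB
  tfae_have 1 → 4 := fun h =>
    DG.SemifreeDGA.subsingleton_of_d_eq_one f (h.exists_d_eq_one hB')
  tfae_have 2 → 4 := fun h =>
    DG.SemifreeDGA.subsingleton_of_d_eq_one f (h.exists_d_eq_one_iff.2 hB')
  tfae_have 3 → 4 := fun h =>
    DG.SemifreeDGA.subsingleton_of_d_eq_one f (h.exists_d_eq_one hB)
  tfae_finish
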